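/- Let $X$ be a measurable space with countably generated $\sigma$-algebra, and let $d_{\mathrm{TV}}(p,q)=\sup_B|p(B)-q(B)|$ (supremum over measurable $B$) for probability distributions $p,q$ on $X$. A class is a set of probability distributions on $X$. A learner $A$ maps, measurably for each $n$, samples $S\in X^n$ to probability distributions on $X$. A randomized learner maps each sample to a random probability distribution on $X$, its law depending measurably on the sample (a Markov kernel). A class $\mathcal C$ is - *$\alpha$-robustly learnable* if there are a learner $A$ and $n_{\mathcal C}:(0,1)^2\to\mathbb N$ such that for every probability distribution $p$ on $X$, all $\epsilon,\delta\in(0,1)$ and all $n\ge n_{\mathcal C}(\epsilon,\delta)$, with probability at least $1-\delta$ over $S\sim p^n$, $d_{\mathrm{TV}}(A(S),p)\le\alpha\inf_{p'\in\mathcal C}d_{\mathrm{TV}}(p,p')+\epsilon$; - *additive $\alpha$-robustly learnable* if there are $A$ and $n_{\mathcal C}:(0,1)^2\to\mathbb N$ such that for every $\eta\in(0,1)$, every probability distribution $q$ on $X$, every $p\in\mathcal C$, all $\epsilon,\delta\in(0,1)$ and all $n\ge n_{\mathcal C}(\epsilon,\delta)$, with probability at least $1-\delta$ over $S\sim(\eta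 q+(1-\eta)p)^n$, $d_{\mathrm{TV}}(A(S),\eta q+(1-\eta)p)\le\alpha\eta+\epsilon$; - *subtractive $\alpha$-robustly learnable* if there are $A$ and $n_{\mathcal C}:(0,1)^2\to\mathbb N$ such that for every $\eta\in(0,1)$, every probability distribution $p$ on $X$ for which some probability distribution $q$ satisfies $\eta q+(1-\eta)p\in\mathcal C$, all $\epsilon,\delta\in(0,1)$ and all $n\ge n_{\mathcal C}(\epsilon,\delta)$, with probability at least $1-\delta$ over $S\sim p^n$, $d_{\mathrm{TV}}(A(S),p)\le\alpha\eta+\epsilon$; - *approximate-DP learnable* if there are a randomized learner $A$ and $n_{\mathcal C}:(0,1)^4\to\mathbb N$ such that for every $p\in\mathcal C$, all $\alpha,\beta,\epsilon,\delta\in(0,1)$ and all $n\ge n_{\mathcal C}(\alpha,\beta,\epsilon,\delta)$: (i) $A$ is $(\epsilon,\delta)$-differentially private on samples of size $n$, i.e. $\Pr[A(x)\in B]\le e^{\epsilon}\Pr[A(x')\in B]+\delta$ for all $x,x'\in X^n$ differing in exactly one entry and all measurable sets $B$ of distributions; and (ii) with probability at least $1-\beta$ over $S\sim p^n$ and the randomness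 of $A$, $d_{\mathrm{TV}}(p,A(S))\le\alpha$. Then: 1. Every approximate-DP learnable class $\mathcal Q$ on every such $X$ is additive $3$-robustly learnable. 2. There is an approximate-DP learnable class $\mathcal Q$ of distributions on $\mathbb N\times\mathbb N$ that is not $\alpha$-robustly learnable for any $\alpha\ge1$. 3. There is an approximate-DP learnable class $\mathcal Q$ of distributions on $\mathbb N\times\mathbb N$ that is not subtractive $\alpha$-robustly learnable for any $\alpha\ge1$. -/

import Mathlib

open MeasureTheory ProbabilityTheory

namespace DistLearn

/-- Total variation distance `sup_B |p(B) - q(B)|` over the measurable sets `B`. -/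
noncomputable def tvDist {X : Type*} [MeasurableSpace X] (p q : ProbabilityMeasure X) : ℝ :=
  ⨆ B : {B : Set X // MeasurableSet B}, |(p : Measure X).real B - (q : Measure X).real B|

/-- `inf_{p' ∈ C} d_TV(p, p')`, with the convention that it is `∞` when `C` is empty. -/
noncomputable def tvDistToClass {X : Type*} [MeasurableSpace X]
    (p : ProbabilityMeasure X) (C : Set (ProbabilityMeasure X)) : ENNReal :=
  ⨅ p' ∈ C, ENNReal.ofReal (tvDist p p')

/-- The mixture `η q + (1 - η) p`. -/
noncomputable def mixture {X : Type*} [MeasurableSpace X] (η : ℝ) (hη : η ∈ Set.Ioo (0 : ℝ) 1)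
    (q p : ProbabilityMeasure X) : ProbabilityMeasure X :=
  ⟨ENNReal.ofReal η • (q : Measure X) + ENNReal.ofReal (1 - η) • (p : Measure X), ⟨by
    simp only [Measure.coe_add, Measure.coe_smul, Pi.add_apply, Pi.smul_apply, measure_univ,
      smul_eq_mul, mul_one]
    rw [← ENNReal.ofReal_add hη.1.le (by linarith [hη.2])]
    simp⟩⟩

/-- The law `p^n` of an i.i.d. sample of size `n` from `p`. -/
noncomputable def iidSample {X : Type*} [MeasurableSpace X] (p : ProbabilityMeasure X) (n : ℕ) :
    Measure (Fin n → X) :=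
  Measure.pi fun _ => (p : Measure X)

/-- A learner: for every sample size, a measurable map from samples to distributions. -/
structure Learner (X : Type*) [MeasurableSpace X] where
  out : (n : ℕ) → (Fin n → X) → ProbabilityMeasure X
  measurable_out : ∀ n, Measurable (out n)

/-- A randomized learner: for every sample size, a Markov kernel from samples to distributions,
that is, the law of the (random) output given the sample. -/
structure RandomizedLearner (X : Type*) [MeasurableSpace X] where
  out : (n : ℕ) → Kernel (Fin n → X) (ProbabilityMeasure X)
  isMarkovKernel_out : ∀ n, IsMarkovKernel (out n)

/-- `C` is `α`-robustly learnable. -/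
def RobustlyLearnable {X : Type*} [MeasurableSpace X] (α : ℝ)
    (C : Set (ProbabilityMeasure X)) : Prop :=
  ∃ (A : Learner X) (nC : ℝ → ℝ → ℕ), ∀ p : ProbabilityMeasure X,
    ∀ ε ∈ Set.Ioo (0 : ℝ) 1, ∀ δ ∈ Set.Ioo (0 : ℝ) 1, ∀ n ≥ nC ε δ,
      ENNReal.ofReal (1 - δ) ≤ iidSample p n
        {S | ENNReal.ofReal (tvDist (A.out n S) p) ≤
          ENNReal.ofReal α * tvDistToClass p C + ENNReal.ofReal ε}

/-- `C` is additive `α`-robustly learnable. -/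
def AdditiveRobustlyLearnable {X : Type*} [MeasurableSpace X] (α : ℝ)
    (C : Set (ProbabilityMeasure X)) : Prop :=
  ∃ (A : Learner X) (nC : ℝ → ℝ → ℕ),
    ∀ (η : ℝ) (hη : η ∈ Set.Ioo (0 : ℝ) 1) (q : ProbabilityMeasure X), ∀ p ∈ C,
    ∀ ε ∈ Set.Ioo (0 : ℝ) 1, ∀ δ ∈ Set.Ioo (0 : ℝ) 1, ∀ n ≥ nC ε δ,
      ENNReal.ofReal (1 - δ) ≤ iidSample (mixture η hη q p) n
        {S | tvDist (A.out n S) (mixture η hη q p) ≤ α * η + ε}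

/-- `C` is subtractive `α`-robustly learnable. -/
def SubtractiveRobustlyLearnable {X : Type*} [MeasurableSpace X] (α : ℝ)
    (C : Set (ProbabilityMeasure X)) : Prop :=
  ∃ (A : Learner X) (nC : ℝ → ℝ → ℕ),
    ∀ (η : ℝ) (hη : η ∈ Set.Ioo (0 : ℝ) 1) (p : ProbabilityMeasure X),
    (∃ q : ProbabilityMeasure X, mixture η hη q p ∈ C) →
    ∀ ε ∈ Set.Ioo (0 : ℝ) 1, ∀ δ ∈ Set.Ioo (0 : ℝ) 1, ∀ n ≥ nC ε δ,
      ENNReal.ofReal (1 - δ) ≤ iidSample p n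
        {S | tvDist (A.out n S) p ≤ α * η + ε}

/-- The randomized algorithm `M : X^n → Y` is `(ε, δ)`-differentially private. -/
def IsDP {X Y : Type*} [MeasurableSpace X] [MeasurableSpace Y] {n : ℕ} (ε δ : ℝ)
    (M : Kernel (Fin n → X) Y) : Prop :=
  ∀ x x' : Fin n → X, (∃ i, x i ≠ x' i ∧ ∀ j, j ≠ i → x j = x' j) →
    ∀ B : Set Y, MeasurableSet B →
      M x B ≤ ENNReal.ofReal (Real.exp ε) * M x' B + ENNReal.ofReal δ

/-- `C` is approximate DP learnable. The measure `A.out n ∘ₘ iidSample p n` is the law of the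
output of `A` when the sample is drawn i.i.d. from `p`. -/
def ApproxDPLearnable {X : Type*} [MeasurableSpace X] (C : Set (ProbabilityMeasure X)) : Prop :=
  ∃ (A : RandomizedLearner X) (nC : ℝ → ℝ → ℝ → ℝ → ℕ), ∀ p ∈ C,
    ∀ α ∈ Set.Ioo (0 : ℝ) 1, ∀ β ∈ Set.Ioo (0 : ℝ) 1,
    ∀ ε ∈ Set.Ioo (0 : ℝ) 1, ∀ δ ∈ Set.Ioo (0 : ℝ) 1, ∀ n ≥ nC α β ε δ,
      IsDP ε δ (A.out n) ∧
      ENNReal.ofReal (1 - β) ≤ (A.out n ∘ₘ iidSample p n) {h | tvDist p h ≤ α}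

end DistLearn

/-!
A constant failure probability `δ` makes privacy free. Replacing a random output by its mean does
not increase the expected error, and running a learner on a randomly chosen one of `K` disjoint
blocks of the sample is private with failure probability `1 / K`; so approximate DP learnability is
plain learnability.

Additive contamination at a rate `η < 1 / 3` leaves a batch of `m` points clean with probability at
least `(2 / 3) ^ m`, so that among many batches one gives an estimate at distance about `η`. The
minimum distance test of Yatracos, run on fresh points, picks a candidate that is at most three
times as far away as the best one. For `η ≥ 1 / 3` the bound `3 η` is trivial.

For the lower bounds, give the parameters of a distribution a code point of mass `w ^ 2`, and let
the remaining part hide a random set in observations of weight `w`. Any sample that contains the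
code point reveals the distribution. An adversary who subtracts the code point spends `η = w ^ 2`
and leaves a hard part: membership of unseen positions cannot be guessed, which costs an error of
order `w`, and `w` exceeds any given multiple of `w ^ 2` when it is small. Subtraction moves a
distribution by at most `η`, so a robust learner would cope with it.
-/

namespace DistLearn

section TotalVariation

variable {X : Type*} [MeasurableSpace X]

lemma abs_measureReal_sub_le_one (μ ν : Measure X) [IsZeroOrProbabilityMeasure μ]
    [IsZeroOrProbabilityMeasure ν] (B : Set X) : |μ.real B - ν.real B| ≤ 1 :=
  abs_sub_le_of_nonneg_of_le measureReal_nonneg measureReal_le_one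
    measureReal_nonneg measureReal_le_one

lemma bddAbove_range_abs_measureReal_sub {ι : Sort*} (μ ν : Measure X)
    [IsZeroOrProbabilityMeasure μ] [IsZeroOrProbabilityMeasure ν] (B : ι → Set X) :
    BddAbove (Set.range fun i => |μ.real (B i) - ν.real (B i)|) :=
  ⟨1, Set.forall_mem_range.2 fun _ => abs_measureReal_sub_le_one μ ν _⟩

lemma abs_measureReal_sub_le_tvDist (p q : ProbabilityMeasure X) {B : Set X}
    (hB : MeasurableSet B) :
    |(p : Measure X).real B - (q : Measure X).real B| ≤ tvDist p q :=
  le_ciSup (bddAbove_range_abs_measureReal_sub (p : Measure X) (q : Measure X)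
    ((↑) : {B : Set X // MeasurableSet B} → Set X)) ⟨B, hB⟩

lemma measureReal_sub_le_tvDist (p q : ProbabilityMeasure X) {B : Set X}
    (hB : MeasurableSet B) : (p : Measure X).real B - (q : Measure X).real B ≤ tvDist p q :=
  (le_abs_self _).trans (abs_measureReal_sub_le_tvDist p q hB)

lemma tvDist_le {p q : ProbabilityMeasure X} {r : ℝ}
    (h : ∀ B, MeasurableSet B → |(p : Measure X).real B - (q : Measure X).real B| ≤ r) :
    tvDist p q ≤ r :=
  haveI : Nonempty {B : Set X // MeasurableSet B} := ⟨⟨∅, .empty⟩⟩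
  ciSup_le fun B => h B B.2

lemma tvDist_le_of_measureReal_sub_le {p q : ProbabilityMeasure X} {r : ℝ}
    (h : ∀ B, MeasurableSet B → (p : Measure X).real B - (q : Measure X).real B ≤ r) :
    tvDist p q ≤ r := by
  refine tvDist_le fun B hB => abs_le.2 ⟨?_, h B hB⟩
  have hcompl := h Bᶜ hB.compl
  rw [probReal_compl_eq_one_sub hB, probReal_compl_eq_one_sub hB] at hcompl
  linarith

lemma tvDist_nonneg (p q : ProbabilityMeasure X) : 0 ≤ tvDist p q :=
  (abs_nonneg _).trans (abs_measureReal_sub_le_tvDist p q .empty)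

lemma tvDist_le_one (p q : ProbabilityMeasure X) : tvDist p q ≤ 1 :=
  tvDist_le fun B _ => abs_measureReal_sub_le_one _ _ B

lemma tvDist_self (p : ProbabilityMeasure X) : tvDist p p = 0 :=
  (tvDist_le fun B _ => by simp).antisymm (tvDist_nonneg p p)

lemma tvDist_comm (p q : ProbabilityMeasure X) : tvDist p q = tvDist q p := by
  simp only [tvDist, abs_sub_comm]

lemma tvDist_triangle (p q r : ProbabilityMeasure X) :
    tvDist p r ≤ tvDist p q + tvDist q r :=
  tvDist_le fun _ hB => (abs_sub_le _ _ _).trans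
    (add_le_add (abs_measureReal_sub_le_tvDist p q hB) (abs_measureReal_sub_le_tvDist q r hB))

lemma mixture_real_apply {η : ℝ} (hη : η ∈ Set.Ioo (0 : ℝ) 1) (q p : ProbabilityMeasure X)
    (B : Set X) : (mixture η hη q p : Measure X).real B =
      η * (q : Measure X).real B + (1 - η) * (p : Measure X).real B := by
  have hfinite (c : ℝ) (r : ProbabilityMeasure X) : (ENNReal.ofReal c • (r : Measure X)) B ≠ ⊤ :=
    ENNReal.mul_ne_top ENNReal.ofReal_ne_top (measure_ne_top _ B)
  change (ENNReal.ofReal η • (q : Measure X) + ENNReal.ofReal (1 - η) • (p : Measure X)).real B = _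
  rw [measureReal_add_apply (hfinite _ _) (hfinite _ _), measureReal_ennreal_smul_apply,
    measureReal_ennreal_smul_apply, ENNReal.toReal_ofReal hη.1.le,
    ENNReal.toReal_ofReal (sub_nonneg.2 hη.2.le)]

lemma tvDist_mixture_le {η : ℝ} (hη : η ∈ Set.Ioo (0 : ℝ) 1) (q p : ProbabilityMeasure X) :
    tvDist p (mixture η hη q p) ≤ η := by
  refine tvDist_le fun B _ => ?_
  rw [mixture_real_apply]
  calc _ = |η * ((p : Measure X).real B - (q : Measure X).real B)| := by ring_nf
    _ = η * |(p : Measure X).real B - (q : Measure X).real B| := by rw [abs_mul, abs_of_pos hη.1]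
    _ ≤ η := mul_le_of_le_one_right hη.1.le (abs_measureReal_sub_le_one _ _ B)

lemma exists_seq_measureReal_symmDiff_lt (X : Type*) [MeasurableSpace X]
    [MeasurableSpace.CountablyGenerated X] :
    ∃ U : ℕ → Set X, (∀ k, MeasurableSet (U k)) ∧ ∀ (μ : Measure X) [IsFiniteMeasure μ] (B : Set X),
      MeasurableSet B → ∀ ε > 0, ∃ k, μ.real (symmDiff B (U k)) < ε := by
  obtain ⟨b, hb, hgen⟩ := MeasurableSpace.CountablyGenerated.isCountablyGenerated (α := X)
  have hA : IsSetAlgebra (generateSetAlgebra b) := isSetAlgebra_generateSetAlgebra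
  have hgen' : ‹MeasurableSpace X› = .generateFrom (generateSetAlgebra b) := by
    rw [generateFrom_generateSetAlgebra_eq, hgen]
  obtain ⟨U, hU⟩ := (countable_generateSetAlgebra hb).exists_eq_range ⟨_, hA.empty_mem⟩
  refine ⟨U, fun k => ?_, fun μ _ B hB ε hε => ?_⟩
  · exact hgen' ▸ MeasurableSpace.measurableSet_generateFrom (hU ▸ Set.mem_range_self k)
  · obtain ⟨t, ht, hBt⟩ := (Measure.MeasureDense.of_generateFrom_isSetAlgebra_finite
      μ hA hgen').approx B hB (measure_ne_top _ _) ε hε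
    obtain ⟨k, rfl⟩ : t ∈ Set.range U := hU ▸ ht
    exact ⟨k, (ENNReal.lt_ofReal_iff_toReal_lt (measure_ne_top _ _)).1 hBt⟩

lemma exists_seq_tvDist_sub_lt (X : Type*) [MeasurableSpace X]
    [MeasurableSpace.CountablyGenerated X] :
    ∃ U : ℕ → Set X, (∀ k, MeasurableSet (U k)) ∧ ∀ (p q : ProbabilityMeasure X), ∀ ε > 0,
      ∃ k, tvDist p q - ε < |(p : Measure X).real (U k) - (q : Measure X).real (U k)| := by
  obtain ⟨U, hU, hdense⟩ := exists_seq_measureReal_symmDiff_lt X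
  refine ⟨U, hU, fun p q ε hε => ?_⟩
  have : Nonempty {B : Set X // MeasurableSet B} := ⟨⟨∅, .empty⟩⟩
  obtain ⟨⟨B, hB⟩, hpq⟩ := exists_lt_of_lt_ciSup (sub_lt_self (tvDist p q) (half_pos hε))
  obtain ⟨k, hk⟩ := hdense ((p : Measure X) + q) B hB (ε / 2) (half_pos hε)
  rw [measureReal_add_apply] at hk
  have hclose (r : ProbabilityMeasure X) : |(r : Measure X).real B - (r : Measure X).real (U k)| ≤
      (r : Measure X).real (symmDiff B (U k)) :=
    abs_measureReal_sub_le_measureReal_symmDiff' hB.nullMeasurableSet (hU k).nullMeasurableSet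
      (measure_ne_top _ _) (measure_ne_top _ _)
  have hp := hclose p
  have hq := hclose q
  have htriangle : |(p : Measure X).real B - (q : Measure X).real B| ≤
      |(p : Measure X).real B - (p : Measure X).real (U k)| +
        |(p : Measure X).real (U k) - (q : Measure X).real (U k)| +
        |(q : Measure X).real B - (q : Measure X).real (U k)| := by
    rw [abs_sub_comm ((q : Measure X).real B)]
    exact (abs_sub_le _ ((q : Measure X).real (U k)) _).trans (by gcongr; exact abs_sub_le _ _ _)
  exact ⟨k, by linarith⟩

lemma measurable_toMeasure : Measurable ((↑) : ProbabilityMeasure X → Measure X) :=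
  measurable_subtype_coe

variable {Ω : Type*} [MeasurableSpace Ω] {f g : Ω → ProbabilityMeasure X}

lemma measurable_measureReal (hf : Measurable f) {B : Set X} (hB : MeasurableSet B) :
    Measurable fun ω => (f ω : Measure X).real B :=
  ((Measure.measurable_coe hB).comp (measurable_toMeasure.comp hf)).ennreal_toReal

lemma measurable_tvDist [MeasurableSpace.CountablyGenerated X] (hf : Measurable f)
    (hg : Measurable g) : Measurable fun ω => tvDist (f ω) (g ω) := by
  obtain ⟨U, hU, hnear⟩ := exists_seq_tvDist_sub_lt X
  have htv (p q : ProbabilityMeasure X) :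
      tvDist p q = ⨆ k, |(p : Measure X).real (U k) - (q : Measure X).real (U k)| := by
    refine le_antisymm (le_of_forall_pos_sub_le fun ε hε => ?_)
      (ciSup_le fun k => abs_measureReal_sub_le_tvDist p q (hU k))
    obtain ⟨k, hk⟩ := hnear p q ε hε
    exact hk.le.trans
      (le_ciSup (bddAbove_range_abs_measureReal_sub (p : Measure X) (q : Measure X) U) k)
  simp only [htv]
  exact .iSup fun k =>
    ((measurable_measureReal hf (hU k)).sub (measurable_measureReal hg (hU k))).abs

lemma measurable_tvDist_left [MeasurableSpace.CountablyGenerated X] (p : ProbabilityMeasure X) :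
    Measurable (tvDist p) :=
  measurable_tvDist measurable_const measurable_id

end TotalVariation

section Derandomization

variable {X Y : Type*} [MeasurableSpace X] [MeasurableSpace Y]

/-- The mean (barycentre) of a law on the space of probability distributions. It turns a random
output of a learner into a deterministic one. -/
noncomputable def mean (L : Measure (ProbabilityMeasure X)) [IsProbabilityMeasure L] :
    ProbabilityMeasure X :=
  ⟨L.bind fun h => (h : Measure X),
    ⟨by simp [Measure.bind_apply .univ measurable_toMeasure.aemeasurable]⟩⟩

lemma mean_real_apply (L : Measure (ProbabilityMeasure X)) [IsProbabilityMeasure L] {B : Set X}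
    (hB : MeasurableSet B) : (mean L : Measure X).real B = ∫ h, (h : Measure X).real B ∂L := by
  have hbind : (mean L : Measure X) B = ∫⁻ h, (h : Measure X) B ∂L :=
    Measure.bind_apply hB measurable_toMeasure.aemeasurable
  simp only [measureReal_def, hbind]
  exact (integral_toReal ((Measure.measurable_coe hB).comp measurable_toMeasure).aemeasurable
    (.of_forall fun h => measure_lt_top _ _)).symm

lemma measurable_mean (κ : Kernel Y (ProbabilityMeasure X)) [IsMarkovKernel κ] :
    Measurable fun y => mean (κ y) :=
  ((Measure.measurable_bind' measurable_toMeasure).comp κ.measurable).subtype_mk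

variable [MeasurableSpace.CountablyGenerated X]

lemma tvDist_mean_le_integral (p : ProbabilityMeasure X) (L : Measure (ProbabilityMeasure X))
    [IsProbabilityMeasure L] : tvDist p (mean L) ≤ ∫ h, tvDist p h ∂L := by
  refine tvDist_le_of_measureReal_sub_le fun B hB => ?_
  have hB_int : Integrable (fun h : ProbabilityMeasure X => (h : Measure X).real B) L :=
    .of_mem_Icc 0 1 (measurable_measureReal measurable_id hB).aemeasurable
      (.of_forall fun _ => ⟨measureReal_nonneg, measureReal_le_one⟩)
  have htv_int : Integrable (fun h => tvDist p h) L :=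
    .of_mem_Icc 0 1 (measurable_tvDist_left p).aemeasurable
      (.of_forall fun _ => ⟨tvDist_nonneg _ _, tvDist_le_one _ _⟩)
  calc (p : Measure X).real B - (mean L : Measure X).real B
      = ∫ h, ((p : Measure X).real B - (h : Measure X).real B) ∂L := by
        rw [mean_real_apply L hB, integral_sub (integrable_const _) hB_int]; simp
    _ ≤ ∫ h, tvDist p h ∂L := integral_mono ((integrable_const _).sub hB_int) htv_int
        fun h => measureReal_sub_le_tvDist p h hB

lemma ofReal_tvDist_mean_le_lintegral (p : ProbabilityMeasure X)
    (L : Measure (ProbabilityMeasure X)) [IsProbabilityMeasure L] :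
    ENNReal.ofReal (tvDist p (mean L)) ≤ ∫⁻ h, ENNReal.ofReal (tvDist p h) ∂L := by
  rw [← ofReal_integral_eq_lintegral_ofReal _ (.of_forall fun h => tvDist_nonneg p h)]
  · exact ENNReal.ofReal_le_ofReal (tvDist_mean_le_integral p L)
  · exact .of_mem_Icc 0 1 (measurable_tvDist_left p).aemeasurable
      (.of_forall fun _ => ⟨tvDist_nonneg _ _, tvDist_le_one _ _⟩)

lemma lintegral_tvDist_le (p : ProbabilityMeasure X) (L : Measure (ProbabilityMeasure X))
    [IsProbabilityMeasure L] (r : ℝ) :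
    ∫⁻ h, ENNReal.ofReal (tvDist p h) ∂L ≤ ENNReal.ofReal r + L {h | r < tvDist p h} := by
  have hfail : MeasurableSet {h | r < tvDist p h} :=
    measurableSet_lt measurable_const (measurable_tvDist_left p)
  calc ∫⁻ h, ENNReal.ofReal (tvDist p h) ∂L
      ≤ ∫⁻ h, (ENNReal.ofReal r + {h | r < tvDist p h}.indicator 1 h) ∂L := by
        refine lintegral_mono fun h => ?_
        by_cases hh : r < tvDist p h
        · simpa [hh] using le_add_left (ENNReal.ofReal_le_one.2 (tvDist_le_one p h))
        · simpa [hh] using ENNReal.ofReal_le_ofReal (not_lt.1 hh)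
    _ = ENNReal.ofReal r + L {h | r < tvDist p h} := by
        rw [lintegral_add_left measurable_const, lintegral_indicator_one hfail]; simp

/-- Markov's inequality for the expected error, which the mean does not increase. -/
lemma measure_lt_tvDist_mean_le (κ : Kernel Y (ProbabilityMeasure X)) [IsMarkovKernel κ]
    (π : Measure Y) [IsProbabilityMeasure π] (p : ProbabilityMeasure X) (r : ℝ) {s : ℝ}
    (hs : 0 < s) :
    π {y | s < tvDist p (mean (κ y))} ≤
      (ENNReal.ofReal r + (κ ∘ₘ π) {h | r < tvDist p h}) / ENNReal.ofReal s := by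
  have htv : Measurable fun h : ProbabilityMeasure X => ENNReal.ofReal (tvDist p h) :=
    (measurable_tvDist_left p).ennreal_ofReal
  calc π {y | s < tvDist p (mean (κ y))}
      ≤ π {y | ENNReal.ofReal s ≤ ENNReal.ofReal (tvDist p (mean (κ y)))} :=
        measure_mono fun y hy => ENNReal.ofReal_le_ofReal (le_of_lt hy)
    _ ≤ (∫⁻ y, ENNReal.ofReal (tvDist p (mean (κ y))) ∂π) / ENNReal.ofReal s :=
        meas_ge_le_lintegral_div (htv.comp (measurable_mean κ)).aemeasurable
          (ENNReal.ofReal_pos.2 hs).ne' ENNReal.ofReal_ne_top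
    _ ≤ (∫⁻ h, ENNReal.ofReal (tvDist p h) ∂(κ ∘ₘ π)) / ENNReal.ofReal s := by
        rw [Measure.lintegral_bind κ.aemeasurable htv.aemeasurable]
        gcongr with y
        exact ofReal_tvDist_mean_le_lintegral p (κ y)
    _ ≤ _ := by gcongr; exact lintegral_tvDist_le p _ r

end Derandomization

section Learnability

variable {X : Type*} [MeasurableSpace X]

instance (p : ProbabilityMeasure X) (n : ℕ) : IsProbabilityMeasure (iidSample p n) :=
  inferInstanceAs (IsProbabilityMeasure (Measure.pi _))

lemma ofReal_one_sub_le_measure_le_iff {Ω : Type*} [MeasurableSpace Ω] {π : Measure Ω}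
    [IsProbabilityMeasure π] {f : Ω → ℝ} (hf : Measurable f) (r : ℝ) {β : ℝ} (hβ : 0 ≤ β) :
    ENNReal.ofReal (1 - β) ≤ π {ω | f ω ≤ r} ↔ π {ω | r < f ω} ≤ ENNReal.ofReal β := by
  have hcompl : {ω | r < f ω} = {ω | f ω ≤ r}ᶜ := by ext; simp
  rw [hcompl, ENNReal.ofReal_le_iff_le_toReal (measure_ne_top _ _),
    ENNReal.le_ofReal_iff_toReal_le (measure_ne_top _ _) hβ, ← measureReal_def, ← measureReal_def,
    probReal_compl_eq_one_sub (measurableSet_le hf measurable_const), sub_le_comm]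

/-- `C` is (realizably, PAC) learnable: some learner is accurate with high probability on i.i.d.
samples from the distributions of `C`. This is approximate DP learnability without randomization
and without privacy, neither of which changes the notion. -/
def Learnable (C : Set (ProbabilityMeasure X)) : Prop :=
  ∃ (A : Learner X) (nC : ℝ → ℝ → ℕ), ∀ p ∈ C, ∀ α ∈ Set.Ioo (0 : ℝ) 1, ∀ β ∈ Set.Ioo (0 : ℝ) 1,
    ∀ n ≥ nC α β, ENNReal.ofReal (1 - β) ≤ iidSample p n {S | tvDist p (A.out n S) ≤ α}

theorem ApproxDPLearnable.learnable [MeasurableSpace.CountablyGenerated X]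
    {C : Set (ProbabilityMeasure X)} (hC : ApproxDPLearnable C) : Learnable C := by
  obtain ⟨A, nC, hA⟩ := hC
  have := A.isMarkovKernel_out
  refine ⟨⟨fun n S => mean (A.out n S), fun n => measurable_mean (A.out n)⟩,
    fun α β => nC (α * β / 2) (α * β / 2) (1 / 2) (1 / 2), fun p hp α hα β hβ n hn => ?_⟩
  have hαβ : α * β / 2 ∈ Set.Ioo (0 : ℝ) 1 := by
    have hpos := mul_pos hα.1 hβ.1
    have hlt := mul_lt_one_of_nonneg_of_lt_one_left hα.1.le hα.2 hβ.2.le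
    constructor <;> linarith
  have hhalf : (1 / 2 : ℝ) ∈ Set.Ioo (0 : ℝ) 1 := by norm_num
  have hacc := (hA p hp _ hαβ _ hαβ _ hhalf _ hhalf n hn).2
  rw [ofReal_one_sub_le_measure_le_iff (measurable_tvDist_left p) _ hαβ.1.le] at hacc
  refine (ofReal_one_sub_le_measure_le_iff
    (measurable_tvDist measurable_const (measurable_mean (A.out n))) _ hβ.1.le).2 ?_
  calc iidSample p n {S | α < tvDist p (mean (A.out n S))}
      ≤ (ENNReal.ofReal (α * β / 2) + ENNReal.ofReal (α * β / 2)) / ENNReal.ofReal α :=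
        (measure_lt_tvDist_mean_le (A.out n) _ p (α * β / 2) hα.1).trans (by gcongr)
    _ = ENNReal.ofReal β := by
        rw [← ENNReal.ofReal_add hαβ.1.le hαβ.1.le, ← ENNReal.ofReal_div_of_pos hα.1, add_halves,
          mul_div_cancel_left₀ _ hα.1.ne']

end Learnability

section EmpiricalFrequency

variable {X : Type*} [MeasurableSpace X] {N : ℕ} {B : Set X}

/-- The empirical frequency of the set `B` in the sample `T`. -/
noncomputable def empiricalFreq (T : Fin N → X) (B : Set X) : ℝ :=
  (N : ℝ)⁻¹ * ∑ i, B.indicator 1 (T i)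

lemma measurable_empiricalFreq (hB : MeasurableSet B) :
    Measurable fun T : Fin N → X => empiricalFreq T B :=
  (Finset.measurable_fun_sum _ fun i _ =>
    (measurable_one.indicator hB).comp (measurable_pi_apply i)).const_mul _

lemma memLp_indicator_one_eval (μ : ProbabilityMeasure X) (hB : MeasurableSet B) (i : Fin N) :
    MemLp (fun T : Fin N → X => B.indicator (1 : X → ℝ) (T i)) 2 (iidSample μ N) :=
  (memLp_indicator_const 2 hB (1 : ℝ) (.inr (measure_ne_top _ _))).comp_measurePreserving
    (measurePreserving_eval (fun _ => (μ : Measure X)) i)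

lemma memLp_empiricalFreq (μ : ProbabilityMeasure X) (hB : MeasurableSet B) :
    MemLp (fun T : Fin N → X => empiricalFreq T B) 2 (iidSample μ N) :=
  (memLp_finsetSum _ fun i _ => memLp_indicator_one_eval μ hB i).const_mul _

lemma integral_empiricalFreq (μ : ProbabilityMeasure X) (hN : N ≠ 0) (hB : MeasurableSet B) :
    ∫ T, empiricalFreq T B ∂(iidSample μ N) = (μ : Measure X).real B := by
  have hcoord (i : Fin N) :
      ∫ T, B.indicator (1 : X → ℝ) (T i) ∂(iidSample μ N) = (μ : Measure X).real B := by
    rw [iidSample, integral_comp_eval (μ := fun _ : Fin N => (μ : Measure X))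
      (measurable_one.indicator hB).aestronglyMeasurable, integral_indicator_one hB]
  simp only [empiricalFreq]
  rw [integral_const_mul, integral_finsetSum _ fun i _ =>
    (memLp_indicator_one_eval μ hB i).integrable one_le_two]
  simp [hcoord, hN]

lemma variance_empiricalFreq_le (μ : ProbabilityMeasure X) (hB : MeasurableSet B) :
    Var[fun T : Fin N → X => empiricalFreq T B; iidSample μ N] ≤ (N : ℝ)⁻¹ := by
  have hcoord : Var[B.indicator (1 : X → ℝ); (μ : Measure X)] ≤ 1 :=
    (variance_le_sq_of_bounded (a := 0) (b := 1)
      (.of_forall fun x => by by_cases hx : x ∈ B <;> simp [hx])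
      (measurable_one.indicator hB).aemeasurable).trans (by norm_num)
  have hsum : Var[fun T : Fin N → X => ∑ i, B.indicator (1 : X → ℝ) (T i); iidSample μ N] ≤ N := by
    have hsum_fun : (fun T : Fin N → X => ∑ i, B.indicator (1 : X → ℝ) (T i)) =
        ∑ i, fun T => B.indicator (1 : X → ℝ) (T i) := by ext T; simp
    rw [hsum_fun, iidSample, variance_sum_pi (X := fun _ : Fin N => B.indicator (1 : X → ℝ))
      fun _ => memLp_indicator_const 2 hB (1 : ℝ) (.inr (measure_ne_top _ _))]
    exact (Finset.sum_le_sum fun _ _ => hcoord).trans_eq (by simp)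
  simp only [empiricalFreq]
  rw [variance_const_mul]
  calc ((N : ℝ)⁻¹) ^ 2 * _ ≤ ((N : ℝ)⁻¹) ^ 2 * N := by gcongr
    _ = (N : ℝ)⁻¹ := by rcases eq_or_ne (N : ℝ) 0 with h | h <;> [simp [h]; field_simp]

lemma iidSample_lt_abs_empiricalFreq_sub_le (μ : ProbabilityMeasure X) (hN : N ≠ 0)
    (hB : MeasurableSet B) {ε : ℝ} (hε : 0 < ε) :
    iidSample μ N {T | ε < |empiricalFreq T B - (μ : Measure X).real B|} ≤
      ENNReal.ofReal (1 / (N * ε ^ 2)) := by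
  have hchebyshev := meas_ge_le_variance_div_sq (memLp_empiricalFreq (N := N) μ hB) hε
  rw [integral_empiricalFreq μ hN hB] at hchebyshev
  refine (measure_mono (Set.ofPred_subset_ofPred.2 fun T => le_of_lt)).trans (hchebyshev.trans ?_)
  rw [one_div, mul_inv, ← div_eq_mul_inv]
  gcongr
  exact variance_empiricalFreq_le μ hB

lemma iidSample_exists_lt_abs_empiricalFreq_sub_le {ι : Type*} [Fintype ι]
    (μ : ProbabilityMeasure X) (hN : N ≠ 0) {V : ι → Set X} (hV : ∀ i, MeasurableSet (V i)) {ε : ℝ}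
    (hε : 0 < ε) :
    iidSample μ N {T | ∃ i, ε < |empiricalFreq T (V i) - (μ : Measure X).real (V i)|} ≤
      ENNReal.ofReal (Fintype.card ι / (N * ε ^ 2)) := by
  rw [Set.ofPred_exists]
  calc _ ≤ ∑ i, iidSample μ N {T | ε < |empiricalFreq T (V i) - (μ : Measure X).real (V i)|} :=
        measure_iUnion_fintype_le _ _
    _ ≤ ∑ _i : ι, ENNReal.ofReal (1 / (N * ε ^ 2)) := Finset.sum_le_sum fun i _ =>
        iidSample_lt_abs_empiricalFreq_sub_le μ hN (hV i) hε
    _ = ENNReal.ofReal (Fintype.card ι / (N * ε ^ 2)) := by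
        rw [Finset.sum_const, ← ENNReal.ofReal_nsmul, Finset.card_univ, nsmul_eq_mul, mul_one_div]

end EmpiricalFrequency

section MeasurableChoice

variable {Ω ι : Type*} [MeasurableSpace Ω] [MeasurableSpace ι]

lemma exists_measurable_choice [Countable ι] [Nonempty ι] {R : Ω → ι → Prop}
    (hR : ∀ i, MeasurableSet {ω | R ω i}) (hex : ∀ ω, ∃ i, R ω i) :
    ∃ c : Ω → ι, Measurable c ∧ ∀ ω, R ω (c ω) := by
  classical
  obtain ⟨e, he⟩ := exists_surjective_nat ι
  have hex' (ω : Ω) : ∃ k, R ω (e k) := by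
    obtain ⟨i, hi⟩ := hex ω
    obtain ⟨k, rfl⟩ := he i
    exact ⟨k, hi⟩
  exact ⟨fun ω => e (Nat.find (hex' ω)),
    (measurable_from_nat (f := e)).comp (measurable_find hex' fun k => hR (e k)),
    fun ω => Nat.find_spec (hex' ω)⟩

lemma exists_measurable_argmin [Finite ι] [Nonempty ι] {F : ι → Ω → ℝ}
    (hF : ∀ i, Measurable (F i)) :
    ∃ c : Ω → ι, Measurable c ∧ ∀ ω i, F (c ω) ω ≤ F i ω := by
  refine exists_measurable_choice (R := fun ω a => ∀ i, F a ω ≤ F i ω) (fun a => ?_)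
    fun ω => Finite.exists_min fun i => F i ω
  rw [Set.ofPred_forall]
  exact .iInter fun i => measurableSet_le (hF a) (hF i)

lemma measurable_apply_of_countable {γ : Type*} [MeasurableSpace γ] [Countable ι]
    [MeasurableSingletonClass ι] {F : ι → Ω → γ} (hF : ∀ i, Measurable (F i)) {c : Ω → ι}
    (hc : Measurable c) : Measurable fun ω => F (c ω) ω :=
  (measurable_from_prod_countable_left (f := fun z : Ω × ι => F z.2 z.1) hF).comp
    (measurable_id.prodMk hc)

end MeasurableChoice

section MinimumDistance

variable {X ι : Type*} [MeasurableSpace X]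

/-- The score of the candidate `H i` in the minimum distance test of Yatracos: its largest
discrepancy from the estimated probabilities `e` on the sets `V i j`, where `V i j` is meant to
separate `H i` from `H j`. -/
noncomputable def maxDiscrepancy (H : ι → ProbabilityMeasure X) (V : ι → ι → Set X)
    (e : Set X → ℝ) (i : ι) : ℝ :=
  ⨆ j, |(H i : Measure X).real (V i j) - e (V i j)|

lemma maxDiscrepancy_le {H : ι → ProbabilityMeasure X} {V : ι → ι → Set X} {e : Set X → ℝ}
    {μ : ProbabilityMeasure X} {ε : ℝ} {i : ι} (hV : ∀ j, MeasurableSet (V i j))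
    (he : ∀ j, |e (V i j) - (μ : Measure X).real (V i j)| ≤ ε) :
    maxDiscrepancy H V e i ≤ tvDist (H i) μ + ε := by
  have : Nonempty ι := ⟨i⟩
  refine ciSup_le fun j => (abs_sub_le _ ((μ : Measure X).real (V i j)) _).trans ?_
  rw [abs_sub_comm _ (e _)]
  exact add_le_add (abs_measureReal_sub_le_tvDist _ _ (hV j)) (he j)

lemma tvDist_le_of_maxDiscrepancy_le [Finite ι] {H : ι → ProbabilityMeasure X}
    {V : ι → ι → Set X} (hV : ∀ i j, MeasurableSet (V i j)) {ε : ℝ}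
    (hsep : ∀ i j, tvDist (H i) (H j) - ε ≤
      |(H i : Measure X).real (V i j) - (H j : Measure X).real (V i j)|)
    {e : Set X → ℝ} {μ : ProbabilityMeasure X}
    (he : ∀ i j, |e (V i j) - (μ : Measure X).real (V i j)| ≤ ε) {a i : ι}
    (hai : maxDiscrepancy H V e a ≤ maxDiscrepancy H V e i) :
    tvDist (H a) μ ≤ 3 * tvDist (H i) μ + 3 * ε := by
  have hfit : |(H a : Measure X).real (V a i) - e (V a i)| ≤ tvDist (H i) μ + ε :=
    (le_ciSup (Set.finite_range fun j => |(H a : Measure X).real (V a j) - e (V a j)|).bddAbove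
      i).trans (hai.trans (maxDiscrepancy_le (hV i) (he i)))
  have htriangle : |(H a : Measure X).real (V a i) - (H i : Measure X).real (V a i)| ≤
      |(H a : Measure X).real (V a i) - e (V a i)| + |e (V a i) - (μ : Measure X).real (V a i)| +
        |(μ : Measure X).real (V a i) - (H i : Measure X).real (V a i)| :=
    (abs_sub_le _ ((μ : Measure X).real (V a i)) _).trans (by gcongr; exact abs_sub_le _ _ _)
  have hμ := abs_measureReal_sub_le_tvDist μ (H i) (hV a i)
  rw [tvDist_comm] at hμ
  linarith [hsep a i, he a i, tvDist_triangle (H a) (H i) μ]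

lemma exists_measurable_separating_index (X : Type*) [MeasurableSpace X]
    [MeasurableSpace.CountablyGenerated X] {ε : ℝ} (hε : 0 < ε) :
    ∃ (U : ℕ → Set X) (k : ProbabilityMeasure X × ProbabilityMeasure X → ℕ),
      (∀ l, MeasurableSet (U l)) ∧ Measurable k ∧ ∀ h, tvDist h.1 h.2 - ε <
        |(h.1 : Measure X).real (U (k h)) - (h.2 : Measure X).real (U (k h))| := by
  obtain ⟨U, hU, hnear⟩ := exists_seq_tvDist_sub_lt X
  obtain ⟨k, hk, hsep⟩ := exists_measurable_choice
    (R := fun (h : ProbabilityMeasure X × ProbabilityMeasure X) (l : ℕ) =>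
      tvDist h.1 h.2 - ε < |(h.1 : Measure X).real (U l) - (h.2 : Measure X).real (U l)|)
    (fun l => measurableSet_lt ((measurable_tvDist measurable_fst measurable_snd).sub_const ε)
      ((measurable_measureReal measurable_fst (hU l)).sub
        (measurable_measureReal measurable_snd (hU l))).abs)
    (fun h => hnear h.1 h.2 ε hε)
  exact ⟨U, k, hU, hk, hsep⟩

lemma measurable_maxDiscrepancy [Countable ι] {N : ℕ} {U : ℕ → Set X}
    (hU : ∀ l, MeasurableSet (U l)) {k : ProbabilityMeasure X × ProbabilityMeasure X → ℕ}
    (hk : Measurable k) (i : ι) :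
    Measurable fun ω : (ι → ProbabilityMeasure X) × (Fin N → X) =>
      maxDiscrepancy ω.1 (fun i j => U (k (ω.1 i, ω.1 j))) (empiricalFreq ω.2) i := by
  have hcandidate (i : ι) :
      Measurable fun ω : (ι → ProbabilityMeasure X) × (Fin N → X) => ω.1 i :=
    (measurable_pi_apply i).comp measurable_fst
  refine .iSup fun j => measurable_apply_of_countable
    (F := fun l ω => |(ω.1 i : Measure X).real (U l) - empiricalFreq ω.2 (U l)|) (fun l => ?_)
    (hk.comp ((hcandidate i).prodMk (hcandidate j)))
  exact ((measurable_measureReal (hcandidate i) (hU l)).sub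
    ((measurable_empiricalFreq (hU l)).comp measurable_snd)).abs

lemma exists_measurable_selector [MeasurableSpace.CountablyGenerated X] [Fintype ι] [Nonempty ι]
    {N : ℕ} (hN : N ≠ 0) {ε : ℝ} (hε : 0 < ε) :
    ∃ G : (ι → ProbabilityMeasure X) × (Fin N → X) → ProbabilityMeasure X, Measurable G ∧
      ∀ (μ : ProbabilityMeasure X) (H : ι → ProbabilityMeasure X),
        iidSample μ N {T | ∃ i, 3 * tvDist (H i) μ + 3 * ε < tvDist (G (H, T)) μ} ≤
          ENNReal.ofReal (Fintype.card ι ^ 2 / (N * ε ^ 2)) := by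
  obtain ⟨U, k, hU, hk, hsep⟩ := exists_measurable_separating_index X hε
  let _ : MeasurableSpace ι := ⊤
  obtain ⟨c, hc, hmin⟩ := exists_measurable_argmin
    (measurable_maxDiscrepancy (ι := ι) (N := N) hU hk)
  refine ⟨fun ω => ω.1 (c ω), measurable_apply_of_countable
    (fun i => (measurable_pi_apply i).comp measurable_fst) hc, fun μ H => ?_⟩
  have hunion := iidSample_exists_lt_abs_empiricalFreq_sub_le μ hN
    (V := fun z : ι × ι => U (k (H z.1, H z.2))) (fun z => hU _) hε
  rw [Fintype.card_prod, Nat.cast_mul, ← sq] at hunion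
  refine le_trans (measure_mono fun T => ?_) hunion
  simp only [Set.mem_ofPred_eq]
  contrapose!
  intro hclose i
  exact tvDist_le_of_maxDiscrepancy_le (V := fun i j => U (k (H i, H j)))
    (fun _ _ => hU _) (fun i j => (hsep (H i, H j)).le) (fun i j => hclose (i, j)) (hmin (H, T) i)

end MinimumDistance

section Sampling

variable {X κ : Type*} [MeasurableSpace X] [Fintype κ]

lemma measurePreserving_comp_of_injective {τ : Type*} [Fintype τ] (p : Measure X)
    [IsProbabilityMeasure p] {e : τ → κ} (he : e.Injective) :
    MeasurePreserving (fun (x : κ → X) t => x (e t)) (Measure.pi fun _ => p)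
      (Measure.pi fun _ => p) := by
  have hindep : iIndepFun (fun (i : κ) (x : κ → X) => x i) (Measure.pi fun _ => p) :=
    iIndepFun_pi (X := fun _ => id) fun _ => aemeasurable_id
  refine ⟨by fun_prop, ?_⟩
  rw [(iIndepFun_iff_map_fun_eq_pi_map fun t => (measurable_pi_apply (e t)).aemeasurable).1
    (hindep.precomp he)]
  simp only [(measurePreserving_eval (fun _ : κ => p) (e _)).map_eq]

lemma measurePreserving_blocks {ι σ τ : Type*} [Fintype ι] [Fintype σ] [Fintype τ] (p : Measure X)
    [IsProbabilityMeasure p] (e : (ι × σ) ⊕ τ ↪ κ) :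
    MeasurePreserving
      (fun x : κ → X => ((fun b t => x (e (.inl (b, t))), fun t => x (e (.inr t))) :
        (ι → σ → X) × (τ → X)))
      (Measure.pi fun _ => p)
      ((Measure.pi fun _ => Measure.pi fun _ => p).prod (Measure.pi fun _ => p)) := by
  have hcurry : MeasurePreserving (MeasurableEquiv.curry ι σ X) (Measure.pi fun _ => p)
      (Measure.pi fun _ => Measure.pi fun _ => p) := by
    refine ⟨MeasurableEquiv.measurable _, ?_⟩
    simpa only [Measure.infinitePi_eq_pi] using
      Measure.infinitePi_map_curry (fun (_ : ι) (_ : σ) => p)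
  exact (hcurry.prod (.id _)).comp ((measurePreserving_sumPiEquivProdPi fun _ => p).comp
    (measurePreserving_comp_of_injective p e.injective))

lemma pow_smul_iidSample_le {p μ : ProbabilityMeasure X} {c : ENNReal}
    (h : c • (p : Measure X) ≤ μ) (m : ℕ) : c ^ m • iidSample p m ≤ iidSample μ m := by
  have hbox : (c ^ m • iidSample p m).toOuterMeasure ≤
      OuterMeasure.pi fun _ : Fin m => (μ : Measure X).toOuterMeasure := by
    refine OuterMeasure.le_pi.2 fun s _ => ?_
    calc (c ^ m • iidSample p m) (Set.univ.pi s) = ∏ i, c * (p : Measure X) (s i) := by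
          simp [iidSample, Measure.pi_pi, Finset.prod_mul_distrib]
      _ ≤ ∏ i, (μ : Measure X) (s i) := Finset.prod_le_prod' fun i _ => by simpa using h (s i)
  refine Measure.le_iff.2 fun E hE => (hbox E).trans_eq ?_
  rw [iidSample, Measure.pi, toMeasure_apply _ _ hE]

lemma measure_prod_le_of_forall_section_le {A B : Type*} [MeasurableSpace A] [MeasurableSpace B]
    (P : Measure A) [IsProbabilityMeasure P] (Q : Measure B) [SFinite Q] {E : Set (A × B)}
    (hE : MeasurableSet E) {c : ENNReal} (h : ∀ a, Q {b | (a, b) ∈ E} ≤ c) : P.prod Q E ≤ c := by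
  rw [Measure.prod_apply hE]
  exact (lintegral_mono h).trans_eq (by simp)

end Sampling

section Boosting

variable {X : Type*} [MeasurableSpace X] [MeasurableSpace.CountablyGenerated X]

lemma exists_measurable_boost {K m N n : ℕ} (hK : K ≠ 0) (hN : N ≠ 0) (hn : K * m + N ≤ n)
    {g : (Fin m → X) → ProbabilityMeasure X} (hg : Measurable g) {ε : ℝ} (hε : 0 < ε) :
    ∃ f : (Fin n → X) → ProbabilityMeasure X, Measurable f ∧ ∀ (μ : ProbabilityMeasure X) (r : ℝ),
      iidSample μ n {S | 3 * r + 3 * ε < tvDist (f S) μ} ≤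
        iidSample μ m {S | r < tvDist (g S) μ} ^ K + ENNReal.ofReal (K ^ 2 / (N * ε ^ 2)) := by
  have : Nonempty (Fin K) := Fin.pos_iff_nonempty.1 (Nat.pos_of_ne_zero hK)
  obtain ⟨e⟩ : Nonempty ((Fin K × Fin m) ⊕ Fin N ↪ Fin n) :=
    Function.Embedding.nonempty_of_card_le (by simpa using hn)
  obtain ⟨G, hG, hselect⟩ := exists_measurable_selector (X := X) (ι := Fin K) hN hε
  let φ (S : Fin n → X) : (Fin K → Fin m → X) × (Fin N → X) :=
    (fun b t => S (e (.inl (b, t))), fun t => S (e (.inr t)))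
  let candidates (z : (Fin K → Fin m → X) × (Fin N → X)) :
    (Fin K → ProbabilityMeasure X) × (Fin N → X) := (fun b => g (z.1 b), z.2)
  have hφ : Measurable φ := by fun_prop
  have hcandidates : Measurable candidates := by fun_prop
  refine ⟨fun S => G (candidates (φ S)), hG.comp (hcandidates.comp hφ), fun μ r => ?_⟩
  let allFail : Set ((Fin K → Fin m → X) × (Fin N → X)) :=
    (Set.univ.pi fun _ => {S | r < tvDist (g S) μ}) ×ˢ Set.univ
  let badSelection : Set ((Fin K → Fin m → X) × (Fin N → X)) :=
    {z | ∃ b, 3 * tvDist (g (z.1 b)) μ + 3 * ε < tvDist (G (candidates z)) μ}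
  have hallFail : MeasurableSet allFail := (MeasurableSet.univ_pi fun _ =>
    measurableSet_lt measurable_const (measurable_tvDist hg measurable_const)).prod .univ
  have hbadSelection : MeasurableSet badSelection := by
    simp only [badSelection, Set.ofPred_exists]
    refine .iUnion fun b => measurableSet_lt ?_ (measurable_tvDist (by fun_prop) measurable_const)
    exact ((measurable_tvDist (by fun_prop) measurable_const).const_mul 3).add_const _
  calc iidSample μ n {S | 3 * r + 3 * ε < tvDist (G (candidates (φ S))) μ}
      ≤ iidSample μ n (φ ⁻¹' (allFail ∪ badSelection)) := by
        refine measure_mono fun S hS => or_iff_not_imp_right.2 fun hgood => ?_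
        simp only [badSelection, Set.mem_ofPred_eq, not_exists, not_lt] at hgood hS
        exact ⟨fun b _ => show r < tvDist (g ((φ S).1 b)) μ by linarith [hgood b], trivial⟩
    _ = ((Measure.pi fun _ => iidSample μ m).prod (iidSample μ N)) (allFail ∪ badSelection) :=
        (measurePreserving_blocks (μ : Measure X) e).measure_preimage
          (hallFail.union hbadSelection).nullMeasurableSet
    _ ≤ _ := by
        refine (measure_union_le _ _).trans (add_le_add ?_ ?_)
        · simp [allFail, Measure.prod_prod, Measure.pi_pi]
        · exact measure_prod_le_of_forall_section_le _ _ hbadSelection fun z =>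
            (hselect μ fun b => g (z b)).trans_eq (by simp)

end Boosting

section AdditiveRobustness

variable {X : Type*} [MeasurableSpace X] {C : Set (ProbabilityMeasure X)}

/-- With probability `(1 - η) ^ m` all `m` sample points come from `p`. -/
lemma pow_mul_le_iidSample_mixture {η : ℝ} (hη : η ∈ Set.Ioo (0 : ℝ) 1)
    (q p : ProbabilityMeasure X) {m : ℕ} (g : (Fin m → X) → ProbabilityMeasure X) (r : ℝ) :
    ENNReal.ofReal (1 - η) ^ m * iidSample p m {S | tvDist p (g S) ≤ r} ≤
      iidSample (mixture η hη q p) m {S | tvDist (g S) (mixture η hη q p) ≤ η + r} := by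
  refine (pow_smul_iidSample_le (μ := mixture η hη q p) (Measure.le_add_left le_rfl) m
    {S | tvDist p (g S) ≤ r}).trans (measure_mono fun S (hS : tvDist p (g S) ≤ r) => ?_)
  have htriangle := tvDist_triangle (g S) p (mixture η hη q p)
  rw [tvDist_comm (g S) p] at htriangle
  exact htriangle.trans (by linarith [tvDist_mixture_le hη q p])

/-- `f` estimates every contamination `η q + (1 - η) p` of a `p ∈ C` up to `α η + ε`, with
probability at least `1 - ε`: one parameter serves as accuracy and as confidence. -/
def IsAdditiveRobustEstimator (α ε : ℝ) (C : Set (ProbabilityMeasure X)) {n : ℕ}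
    (f : (Fin n → X) → ProbabilityMeasure X) : Prop :=
  ∀ (η : ℝ) (hη : η ∈ Set.Ioo (0 : ℝ) 1) (q : ProbabilityMeasure X), ∀ p ∈ C,
    ENNReal.ofReal (1 - ε) ≤ iidSample (mixture η hη q p) n
      {S | tvDist (f S) (mixture η hη q p) ≤ α * η + ε}

lemma exists_pow_add_div_le {x δ ε : ℝ} (hx₀ : 0 ≤ x) (hx : x < 1) (hδ : 0 < δ) (hε : 0 < ε) :
    ∃ K N : ℕ, K ≠ 0 ∧ N ≠ 0 ∧ x ^ K + K ^ 2 / (N * δ ^ 2) ≤ ε := by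
  obtain ⟨K, hK⟩ := exists_pow_lt_of_lt_one (half_pos hε) hx
  obtain ⟨N, hN⟩ := exists_nat_gt (((K + 1 : ℕ) : ℝ) ^ 2 / (ε / 2 * δ ^ 2))
  have hN₀ : (0 : ℝ) < N := lt_of_le_of_lt (by positivity) hN
  refine ⟨K + 1, N, K.succ_ne_zero, (Nat.cast_pos.1 hN₀).ne', ?_⟩
  have hpow : x ^ (K + 1) ≤ ε / 2 := (pow_le_pow_of_le_one hx₀ hx.le K.le_succ).trans hK.le
  have hdiv : ((K + 1 : ℕ) : ℝ) ^ 2 / (N * δ ^ 2) ≤ ε / 2 := by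
    rw [div_lt_iff₀ (by positivity)] at hN
    exact (div_le_iff₀ (by positivity)).2 (by linarith)
  linarith

lemma exists_isAdditiveRobustEstimator [MeasurableSpace.CountablyGenerated X] {ε : ℝ}
    (hε : ε ∈ Set.Ioo (0 : ℝ) 1) {m : ℕ} {g : (Fin m → X) → ProbabilityMeasure X}
    (hg : Measurable g)
    (hgC : ∀ p ∈ C, ENNReal.ofReal (1 / 2) ≤ iidSample p m {S | tvDist p (g S) ≤ ε / 6}) :
    ∃ n₀, ∀ n ≥ n₀, ∃ f : (Fin n → X) → ProbabilityMeasure X,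
      Measurable f ∧ IsAdditiveRobustEstimator 3 ε C f := by
  have hε₀ := hε.1
  have hclean : (2 / 3 : ℝ) ^ m ≤ 1 := pow_le_one₀ (by norm_num) (by norm_num)
  have hclean₀ : 0 < (2 / 3 : ℝ) ^ m := by positivity
  obtain ⟨K, N, hK, hN, hKN⟩ := exists_pow_add_div_le
    (x := 1 - (2 / 3 : ℝ) ^ m * (1 / 2)) (δ := ε / 6) (by linarith) (by linarith)
    (by positivity) hε₀
  refine ⟨K * m + N, fun n hn => ?_⟩
  obtain ⟨f, hf, hboost⟩ :=
    exists_measurable_boost hK hN hn hg (ε := ε / 6) (by positivity)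
  refine ⟨f, hf, fun η hη q p hp => ?_⟩
  rcases le_or_gt (1 / 3) η with hlarge | hsmall
  · have htrivial : {S | tvDist (f S) (mixture η hη q p) ≤ 3 * η + ε} = Set.univ :=
      Set.eq_univ_of_forall fun S => (tvDist_le_one _ _).trans (by linarith)
    simp [htrivial, hε₀.le]
  have hbatch : iidSample (mixture η hη q p) m
      {S | η + ε / 6 < tvDist (g S) (mixture η hη q p)} ≤
        ENNReal.ofReal (1 - (2 / 3) ^ m * (1 / 2)) := by
    refine (ofReal_one_sub_le_measure_le_iff (measurable_tvDist hg measurable_const) _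
      (by linarith)).1 ?_
    rw [sub_sub_cancel, ENNReal.ofReal_mul hclean₀.le, ENNReal.ofReal_pow (by norm_num)]
    refine le_trans ?_ (pow_mul_le_iidSample_mixture hη q p g (ε / 6))
    gcongr
    exacts [by linarith, hgC p hp]
  refine (ofReal_one_sub_le_measure_le_iff (measurable_tvDist hf measurable_const) _ hε₀.le).2 ?_
  calc _ = iidSample (mixture η hη q p) n
        {S | 3 * (η + ε / 6) + 3 * (ε / 6) < tvDist (f S) (mixture η hη q p)} := by ring_nf
    _ ≤ ENNReal.ofReal (1 - (2 / 3) ^ m * (1 / 2)) ^ K +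
        ENNReal.ofReal (K ^ 2 / (N * (ε / 6) ^ 2)) := (hboost _ _).trans (by gcongr)
    _ ≤ ENNReal.ofReal ε := by
        rw [← ENNReal.ofReal_pow (by linarith), ← ENNReal.ofReal_add (by bound) (by positivity)]
        exact ENNReal.ofReal_le_ofReal hKN

/-- The diagonal choice lets `k` tend to infinity with `n`, slowly enough for a witness of
`R k n` to exist. -/
lemma exists_seq_forall_eventually {F : ℕ → Type*} [∀ n, Nonempty (F n)]
    {R : ℕ → ∀ n, F n → Prop} (hmono : ∀ n f, Antitone fun k => R k n f)
    (h : ∀ k, ∃ n₀, ∀ n ≥ n₀, ∃ f, R k n f) :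
    ∃ f : ∀ n, F n, ∀ k, ∃ n₀, ∀ n ≥ n₀, R k n (f n) := by
  classical
  choose n₀ hn₀ using h
  let k (n : ℕ) : ℕ := Nat.findGreatest (fun k => n₀ k ≤ n) n
  have hchoice (n : ℕ) : ∃ f, n₀ (k n) ≤ n → R (k n) n f := by
    by_cases hn : n₀ (k n) ≤ n
    · exact (hn₀ _ n hn).imp fun f hf _ => hf
    · exact ⟨Classical.arbitrary _, fun h => absurd h hn⟩
  choose f hf using hchoice
  refine ⟨f, fun l => ⟨max l (n₀ l), fun n hn => ?_⟩⟩
  have hln : l ≤ n := (le_max_left _ _).trans hn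
  have hn₀l : n₀ l ≤ n := (le_max_right _ _).trans hn
  exact hmono n (f n) (Nat.le_findGreatest hln hn₀l)
    (hf n (Nat.findGreatest_spec (P := fun k => n₀ k ≤ n) hln hn₀l))

lemma IsAdditiveRobustEstimator.mono {α ε ε' : ℝ} (hεε' : ε ≤ ε') {n : ℕ}
    {f : (Fin n → X) → ProbabilityMeasure X} (hf : IsAdditiveRobustEstimator α ε C f) :
    IsAdditiveRobustEstimator α ε' C f := fun η hη q p hp =>
  (ENNReal.ofReal_le_ofReal (by linarith)).trans ((hf η hη q p hp).trans
    (measure_mono (Set.ofPred_subset_ofPred.2 fun S hS => hS.trans (by linarith))))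

lemma additiveRobustlyLearnable_of_forall_exists (A : Learner X) {α : ℝ}
    (h : ∀ ε ∈ Set.Ioo (0 : ℝ) 1, ∃ n₀, ∀ n ≥ n₀, ∃ f : (Fin n → X) → ProbabilityMeasure X,
      Measurable f ∧ IsAdditiveRobustEstimator α ε C f) :
    AdditiveRobustlyLearnable α C := by
  have (n : ℕ) : Nonempty {f : (Fin n → X) → ProbabilityMeasure X // Measurable f} :=
    ⟨⟨A.out n, A.measurable_out n⟩⟩
  obtain ⟨f, hf⟩ := exists_seq_forall_eventually
    (F := fun n => {f : (Fin n → X) → ProbabilityMeasure X // Measurable f})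
    (R := fun k n f => IsAdditiveRobustEstimator α (1 / ((k : ℝ) + 2)) C f.1)
    (fun n f k l hkl hl => hl.mono (by gcongr))
    fun k => (h _ ⟨by positivity, (div_lt_one (by positivity)).2
      (by linarith [k.cast_nonneg (α := ℝ)])⟩).imp fun n₀ hn₀ n hn =>
        (hn₀ n hn).elim fun f hf => ⟨⟨f, hf.1⟩, hf.2⟩
  choose n₀ hn₀ using hf
  refine ⟨⟨fun n => (f n).1, fun n => (f n).2⟩, fun ε δ => n₀ ⌈(min ε δ)⁻¹⌉₊,
    fun η hη q p hp ε hε δ hδ n hn => ?_⟩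
  have hk : 1 / ((⌈(min ε δ)⁻¹⌉₊ : ℝ) + 2) ≤ min ε δ := by
    rw [one_div]
    exact inv_le_of_inv_le₀ (lt_min hε.1 hδ.1) ((Nat.le_ceil _).trans (by linarith))
  refine (ENNReal.ofReal_le_ofReal ?_).trans ((hn₀ _ n hn η hη q p hp).trans (measure_mono
    (Set.ofPred_subset_ofPred.2 fun S hS => hS.trans ?_)))
  · linarith [min_le_right ε δ]
  · linarith [min_le_left ε δ]

theorem Learnable.additiveRobustlyLearnable [MeasurableSpace.CountablyGenerated X]
    (hC : Learnable C) : AdditiveRobustlyLearnable 3 C := by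
  obtain ⟨A, nC, hA⟩ := hC
  refine additiveRobustlyLearnable_of_forall_exists A fun ε hε =>
    exists_isAdditiveRobustEstimator hε (A.measurable_out (nC (ε / 6) (1 / 2))) fun p hp => ?_
  have hacc := hA p hp (ε / 6) ⟨by linarith [hε.1], by linarith [hε.2]⟩ (1 / 2) (by norm_num) _
    le_rfl
  rwa [sub_half] at hacc

end AdditiveRobustness

section Randomization

variable {Ω σ Y : Type*} [MeasurableSpace Ω] [MeasurableSpace σ] [MeasurableSpace Y]

/-- The randomized algorithm that evaluates `F` at its input and at an independent random seed of
law `U`. -/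
noncomputable def seededKernel (U : Measure σ) [SFinite U] (F : Ω × σ → Y) : Kernel Ω Y :=
  (Kernel.id ×ₖ Kernel.const Ω U).map F

variable {U : Measure σ} {F : Ω × σ → Y}

lemma seededKernel_apply [SFinite U] (hF : Measurable F) (x : Ω) {B : Set Y}
    (hB : MeasurableSet B) : seededKernel U F x B = U {s | F (x, s) ∈ B} := by
  rw [seededKernel, Kernel.map_apply' _ hF _ hB, Kernel.prod_apply, Kernel.id_apply,
    Kernel.const_apply, Measure.dirac_prod, Measure.map_apply measurable_prodMk_left (hF hB)]
  rfl

lemma isMarkovKernel_seededKernel [IsProbabilityMeasure U] (hF : Measurable F) :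
    IsMarkovKernel (seededKernel U F) :=
  Kernel.IsMarkovKernel.map _ hF

lemma seededKernel_comp_apply [IsProbabilityMeasure U] (hF : Measurable F) {π : Measure Ω}
    [SFinite π] {B : Set Y} (hB : MeasurableSet B) {c : ENNReal}
    (h : ∀ s, π {x | F (x, s) ∈ B} = c) : (seededKernel U F ∘ₘ π) B = c := by
  rw [Measure.bind_apply hB (Kernel.aemeasurable _)]
  calc ∫⁻ x, seededKernel U F x B ∂π = (π.prod U) (F ⁻¹' B) := by
        rw [Measure.prod_apply (hF hB)]
        exact lintegral_congr fun x => seededKernel_apply hF x hB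
    _ = ∫⁻ _, c ∂U := by
        rw [Measure.prod_apply_symm (hF hB)]
        exact lintegral_congr h
    _ = c := by simp

lemma isDP_seededKernel [SFinite U] {X : Type*} [MeasurableSpace X] {n : ℕ}
    {F : (Fin n → X) × σ → Y} (hF : Measurable F) {ε δ : ℝ} (hε : 0 ≤ ε)
    (h : ∀ x x' : Fin n → X, ∀ i, (∀ j, j ≠ i → x j = x' j) →
      U {s | F (x, s) ≠ F (x', s)} ≤ ENNReal.ofReal δ) :
    IsDP ε δ (seededKernel U F) := by
  rintro x x' ⟨i, -, hi⟩ B hB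
  rw [seededKernel_apply hF x hB, seededKernel_apply hF x' hB]
  calc U {s | F (x, s) ∈ B} ≤ U ({s | F (x', s) ∈ B} ∪ {s | F (x, s) ≠ F (x', s)}) :=
        measure_mono fun s hs => or_iff_not_imp_right.2 fun heq =>
          show F (x', s) ∈ B from not_not.1 heq ▸ hs
    _ ≤ 1 * U {s | F (x', s) ∈ B} + U {s | F (x, s) ≠ F (x', s)} := by
        rw [one_mul]
        exact measure_union_le _ _
    _ ≤ _ := by
        gcongr
        exacts [ENNReal.one_le_ofReal.2 (Real.one_le_exp hε), h x x' i hi]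

end Randomization

section Subsampling

variable {X Y : Type*} [MeasurableSpace X] [MeasurableSpace Y] {K m n : ℕ}

/-- Run `f` on one of `K` disjoint blocks of size `m` of the sample, chosen uniformly at random. -/
noncomputable def subsampleKernel (e : Fin K × Fin m ↪ Fin n) (f : (Fin m → X) → Y) :
    Kernel (Fin n → X) Y :=
  seededKernel (uniformOn (Set.univ : Set (Fin K))) fun z => f fun t => z.1 (e (z.2, t))

variable (e : Fin K × Fin m ↪ Fin n) {f : (Fin m → X) → Y}

lemma measurable_apply_block (hf : Measurable f) :
    Measurable fun z : (Fin n → X) × Fin K => f fun t => z.1 (e (z.2, t)) :=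
  measurable_from_prod_countable_left fun b =>
    hf.comp (measurable_pi_lambda _ fun t => measurable_pi_apply (e (b, t)))

variable [NeZero K]

lemma isMarkovKernel_subsampleKernel (hf : Measurable f) : IsMarkovKernel (subsampleKernel e f) :=
  isMarkovKernel_seededKernel (measurable_apply_block e hf)

/-- Each entry of the sample lies in at most one of the `K` blocks. -/
lemma isDP_subsampleKernel (hf : Measurable f) {ε δ : ℝ} (hε : 0 ≤ ε) (hδ : (K : ℝ)⁻¹ ≤ δ) :
    IsDP ε δ (subsampleKernel e f) := by
  refine isDP_seededKernel (measurable_apply_block e hf) hε fun x x' i hi => ?_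
  have hsub : {b | (f fun t => x (e (b, t))) ≠ f fun t => x' (e (b, t))} ⊆
      {b | ∃ t, e (b, t) = i} := fun b hb => by
    by_contra! hbi
    exact hb (congrArg f (funext fun t => hi _ fun ht => hbi ⟨t, ht⟩))
  have hsubsingleton : {b | ∃ t, e (b, t) = i}.Subsingleton := by
    rintro b ⟨t, ht⟩ b' ⟨t', ht'⟩
    exact congrArg Prod.fst (e.injective (ht.trans ht'.symm))
  refine (measure_mono hsub).trans ?_
  rw [uniformOn_univ, Fintype.card_fin]
  calc _ ≤ (1 : ENNReal) / K := by
        gcongr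
        rw [Measure.count_apply .of_discrete]
        exact_mod_cast Set.encard_le_one_iff_subsingleton.2 hsubsingleton
    _ ≤ ENNReal.ofReal δ := by
        rw [one_div, ← ENNReal.ofReal_natCast, ← ENNReal.ofReal_inv_of_pos (by simp [NeZero.pos])]
        exact ENNReal.ofReal_le_ofReal hδ

lemma subsampleKernel_comp_iidSample (hf : Measurable f) (p : ProbabilityMeasure X) {B : Set Y}
    (hB : MeasurableSet B) : (subsampleKernel e f ∘ₘ iidSample p n) B = iidSample p m (f ⁻¹' B) :=
  seededKernel_comp_apply (measurable_apply_block e hf) hB fun b =>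
    (measurePreserving_comp_of_injective (p : Measure X) (e := fun t => e (b, t))
      fun _ _ h => congrArg Prod.snd (e.injective h)).measure_preimage (hf hB).nullMeasurableSet

theorem Learnable.approxDPLearnable [MeasurableSpace.CountablyGenerated X]
    {C : Set (ProbabilityMeasure X)} (hC : Learnable C) : ApproxDPLearnable C := by
  obtain ⟨A, nC, hA⟩ := hC
  have hblocks (n : ℕ) : Nonempty (Fin (n.sqrt - 1 + 1) × Fin (n.sqrt - 1) ↪ Fin n) := by
    refine Function.Embedding.nonempty_of_card_le ?_
    rw [Fintype.card_prod, Fintype.card_fin, Fintype.card_fin, Fintype.card_fin]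
    rcases Nat.eq_zero_or_pos n.sqrt with hzero | hpos
    · simp [hzero]
    · rw [Nat.sub_add_cancel hpos]
      exact (Nat.mul_le_mul_left _ (Nat.sub_le _ _)).trans (Nat.sqrt_le n)
  let e (n : ℕ) := (hblocks n).some
  refine ⟨⟨fun n => subsampleKernel (e n) (A.out _),
    fun n => isMarkovKernel_subsampleKernel (e n) (A.measurable_out _)⟩,
    fun α β _ δ => (max (nC α β) ⌈δ⁻¹⌉₊ + 1) ^ 2, fun p hp α hα β hβ ε hε δ hδ n hn => ?_⟩
  have hsqrt : max (nC α β) ⌈δ⁻¹⌉₊ ≤ n.sqrt - 1 := Nat.le_sub_one_of_lt (Nat.le_sqrt'.2 hn)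
  constructor
  · refine isDP_subsampleKernel (e n) (A.measurable_out _) hε.1.le ?_
    refine inv_le_of_inv_le₀ hδ.1 ((Nat.le_ceil _).trans ?_)
    exact_mod_cast ((le_max_right _ _).trans hsqrt).trans (Nat.le_succ _)
  · refine (hA p hp α hα β hβ _ ((le_max_left _ _).trans hsqrt)).trans_eq ?_
    exact (subsampleKernel_comp_iidSample (e n) (A.measurable_out _) p
      (measurableSet_le (measurable_tvDist_left p) measurable_const)).symm

end Subsampling

section HardClass

/-- The weight of the part of the distribution that is hard to learn. -/
noncomputable def hardWeight (j : ℕ) : ℝ := 1 / ((j : ℝ) + 2)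

/-- The point mass at `x`. -/
noncomputable def pointMass {X : Type*} [MeasurableSpace X] (x : X) : ProbabilityMeasure X :=
  ⟨Measure.dirac x, inferInstance⟩

/-- The uniform distribution on `{1, …, N + 1}`. -/
noncomputable def uniformIcc (N : ℕ) : ProbabilityMeasure ℕ :=
  ⟨(PMF.uniformOfFinset (Finset.Icc 1 (N + 1)) (Finset.nonempty_Icc.2 (by simp))).toMeasure,
    inferInstance⟩

lemma hardWeight_mem_Ioo (j : ℕ) : hardWeight j ∈ Set.Ioo (0 : ℝ) 1 :=
  ⟨by unfold hardWeight; positivity,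
    (div_lt_one (by positivity)).2 (by linarith [j.cast_nonneg (α := ℝ)])⟩

lemma sq_hardWeight_mem_Ioo (j : ℕ) : hardWeight j ^ 2 ∈ Set.Ioo (0 : ℝ) 1 :=
  ⟨pow_pos (hardWeight_mem_Ioo j).1 2,
    pow_lt_one₀ (hardWeight_mem_Ioo j).1.le (hardWeight_mem_Ioo j).2 two_ne_zero⟩

/-- The law of the position of an observation: `0` most of the time, and otherwise uniform on
`{1, …, N + 1}`. -/
noncomputable def positionLaw (j N : ℕ) : ProbabilityMeasure ℕ :=
  mixture (hardWeight j) (hardWeight_mem_Ioo j) (uniformIcc N) (pointMass 0)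

/-- What is observed at the position `i`: the position itself and, except at `0`, a label that tells
whether it belongs to `b`. The second coordinate `1` is left free for `codePoint`. -/
def observe (b : Finset ℕ) (i : ℕ) : ℕ × ℕ := (i, if i ∈ b ∧ i ≠ 0 then 2 else 0)

/-- The law of an observation. -/
noncomputable def observationLaw (j N : ℕ) (b : Finset ℕ) : ProbabilityMeasure (ℕ × ℕ) :=
  (positionLaw j N).map (f := observe b) Measurable.of_discrete.aemeasurable

/-- The point that identifies the parameters `a = (j, N, b)`. -/
def codePoint (a : ℕ × ℕ × Finset ℕ) : ℕ × ℕ := (Encodable.encode a, 1)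

/-- The law of an observation, mixed with a small point mass that identifies the parameters. These
distributions form the class that is learnable but not robustly learnable. -/
noncomputable def codedLaw (a : ℕ × ℕ × Finset ℕ) : ProbabilityMeasure (ℕ × ℕ) :=
  mixture (hardWeight a.1 ^ 2) (sq_hardWeight_mem_Ioo a.1) (pointMass (codePoint a))
    (observationLaw a.1 a.2.1 a.2.2)

lemma codePoint_injective : Function.Injective codePoint := fun _ _ h =>
  Encodable.encode_injective (congrArg Prod.fst h)

lemma observe_ne_codePoint (a : ℕ × ℕ × Finset ℕ) (b : Finset ℕ) (i : ℕ) :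
    observe b i ≠ codePoint a := fun h => by
  have hlabel : (if i ∈ b ∧ i ≠ 0 then 2 else 0) = 1 := congrArg Prod.snd h
  grind

lemma pointMass_real_apply {X : Type*} [MeasurableSpace X] (x : X) {B : Set X}
    (hB : MeasurableSet B) : (pointMass x : Measure X).real B = B.indicator 1 x := by
  change (Measure.dirac x).real B = _
  by_cases hx : x ∈ B <;> simp [measureReal_def, Measure.dirac_apply' _ hB, hx]

lemma observationLaw_real_apply (j N : ℕ) (b : Finset ℕ) (B : Set (ℕ × ℕ)) :
    (observationLaw j N b : Measure (ℕ × ℕ)).real B =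
      (positionLaw j N : Measure ℕ).real (observe b ⁻¹' B) :=
  map_measureReal_apply .of_discrete .of_discrete

lemma tvDist_observationLaw_le (j N : ℕ) (b : Finset ℕ) :
    tvDist (observationLaw j N b) (pointMass (0, 0)) ≤ hardWeight j := by
  refine tvDist_le fun B _ => ?_
  have hzero : (pointMass ((0, 0) : ℕ × ℕ) : Measure (ℕ × ℕ)).real B =
      (pointMass 0 : Measure ℕ).real (observe b ⁻¹' B) := by
    have hobs : observe b 0 = (0, 0) := by simp [observe]
    rw [pointMass_real_apply _ .of_discrete, pointMass_real_apply _ .of_discrete, ← hobs]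
    rfl
  rw [observationLaw_real_apply, hzero]
  refine (abs_measureReal_sub_le_tvDist _ _ .of_discrete).trans ?_
  rw [tvDist_comm]
  exact tvDist_mixture_le _ _ _

lemma tvDist_codedLaw_le (a : ℕ × ℕ × Finset ℕ) :
    tvDist (codedLaw a) (pointMass (0, 0)) ≤ 2 * hardWeight a.1 := by
  obtain ⟨hw₀, hw₁⟩ := hardWeight_mem_Ioo a.1
  calc tvDist (codedLaw a) (pointMass (0, 0))
      ≤ tvDist (codedLaw a) (observationLaw a.1 a.2.1 a.2.2) +
          tvDist (observationLaw a.1 a.2.1 a.2.2) (pointMass (0, 0)) := tvDist_triangle _ _ _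
    _ ≤ hardWeight a.1 ^ 2 + hardWeight a.1 := by
        rw [tvDist_comm (codedLaw a)]
        exact add_le_add (tvDist_mixture_le _ _ _) (tvDist_observationLaw_le _ _ _)
    _ ≤ 2 * hardWeight a.1 := by nlinarith

lemma ae_codedLaw_eq_of_eq_codePoint (a : ℕ × ℕ × Finset ℕ) :
    ∀ᵐ x ∂(codedLaw a : Measure (ℕ × ℕ)), ∀ a', x = codePoint a' → a' = a := by
  rw [ae_iff, ← measureReal_eq_zero_iff, codedLaw, mixture_real_apply,
    pointMass_real_apply _ .of_discrete, observationLaw_real_apply]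
  have hobserve : observe a.2.2 ⁻¹' {x | ¬ ∀ a', x = codePoint a' → a' = a} = ∅ := by
    simp [observe_ne_codePoint]
  have hcode : codePoint a ∉ {x | ¬ ∀ a', x = codePoint a' → a' = a} :=
    not_not.2 fun a' h => (codePoint_injective h).symm
  rw [hobserve, Set.indicator_of_notMem hcode]
  simp only [measureReal_empty, mul_zero, add_zero]

lemma codedLaw_real_compl_codePoint_le (a : ℕ × ℕ × Finset ℕ) :
    (codedLaw a : Measure (ℕ × ℕ)).real {codePoint a}ᶜ ≤ 1 - hardWeight a.1 ^ 2 := by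
  obtain ⟨-, hw⟩ := sq_hardWeight_mem_Ioo a.1
  rw [codedLaw, mixture_real_apply, pointMass_real_apply _ .of_discrete,
    Set.indicator_of_notMem (by simp), mul_zero, zero_add]
  exact mul_le_of_le_one_right (sub_nonneg.2 hw.le) measureReal_le_one

lemma iidSample_codedLaw_forall_ne_codePoint_le (a : ℕ × ℕ × Finset ℕ) (m : ℕ) :
    iidSample (codedLaw a) m {S | ∀ t, S t ≠ codePoint a} ≤
      ENNReal.ofReal ((1 - hardWeight a.1 ^ 2) ^ m) := by
  have hpi : {S : Fin m → ℕ × ℕ | ∀ t, S t ≠ codePoint a} =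
      Set.univ.pi fun _ => {codePoint a}ᶜ := by ext; simp
  rw [hpi, iidSample, Measure.pi_pi, Finset.prod_const, Finset.card_univ, Fintype.card_fin,
    ← ofReal_measureReal, ← ENNReal.ofReal_pow measureReal_nonneg]
  gcongr
  exact codedLaw_real_compl_codePoint_le a

open Classical in
/-- The learner that outputs the law identified by a code point in the sample, if there is any. -/
noncomputable def decoder : Learner (ℕ × ℕ) where
  out _ S := if h : ∃ a, ∃ t, S t = codePoint a then codedLaw h.choose else pointMass (0, 0)
  measurable_out _ := Measurable.of_discrete

lemma decoder_out_eq_codedLaw {m : ℕ} {S : Fin m → ℕ × ℕ} {a : ℕ × ℕ × Finset ℕ}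
    (hS : ∀ t, ∀ a', S t = codePoint a' → a' = a) (h : ∃ t, S t = codePoint a) :
    decoder.out m S = codedLaw a := by
  have hcode : ∃ a, ∃ t, S t = codePoint a := ⟨a, h⟩
  obtain ⟨t, ht⟩ := hcode.choose_spec
  simp only [decoder, hcode, dite_true, hS t _ ht]

lemma tvDist_decoder_out_le {m : ℕ} {S : Fin m → ℕ × ℕ} {a : ℕ × ℕ × Finset ℕ}
    (hS : ∀ t, ∀ a', S t = codePoint a' → a' = a) :
    tvDist (codedLaw a) (decoder.out m S) ≤ 2 * hardWeight a.1 := by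
  by_cases h : ∃ t, S t = codePoint a
  · rw [decoder_out_eq_codedLaw hS h, tvDist_self]
    exact mul_nonneg zero_le_two (hardWeight_mem_Ioo a.1).1.le
  · have hcode : ¬ ∃ a, ∃ t, S t = codePoint a := by
      rintro ⟨a', t, ht⟩
      exact h ⟨t, hS t a' ht ▸ ht⟩
    simpa only [decoder, hcode, dite_false] using tvDist_codedLaw_le a

lemma iidSample_lt_tvDist_decoder_le (a : ℕ × ℕ × Finset ℕ) {α : ℝ} (hα : α ∈ Set.Ioo (0 : ℝ) 1)
    (m : ℕ) : iidSample (codedLaw a) m {S | α < tvDist (codedLaw a) (decoder.out m S)} ≤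
      ENNReal.ofReal ((1 - (α / 2) ^ 2) ^ m) := by
  have hae : ∀ᵐ S ∂(iidSample (codedLaw a) m), ∀ t, ∀ a', S t = codePoint a' → a' = a :=
    ae_all_iff.2 fun t =>
      (measurePreserving_eval (fun _ : Fin m => (codedLaw a : Measure (ℕ × ℕ))) t
        ).quasiMeasurePreserving.ae (ae_codedLaw_eq_of_eq_codePoint a)
  rcases le_or_gt (2 * hardWeight a.1) α with hsmall | hlarge
  · have hnull : iidSample (codedLaw a) m
        {S | α < tvDist (codedLaw a) (decoder.out m S)} = 0 := by
      refine measure_eq_zero_iff_ae_notMem.2 ?_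
      filter_upwards [hae] with S hS
      exact not_lt.2 ((tvDist_decoder_out_le hS).trans hsmall)
    exact hnull.trans_le zero_le
  · have hmissed : iidSample (codedLaw a) m
        {S | α < tvDist (codedLaw a) (decoder.out m S)} ≤
          iidSample (codedLaw a) m {S | ∀ t, S t ≠ codePoint a} := by
      refine measure_mono_ae ?_
      filter_upwards [hae] with S hS hfail t ht
      refine hα.1.not_gt (hfail.trans_eq ?_)
      rw [decoder_out_eq_codedLaw hS ⟨t, ht⟩, tvDist_self]
    refine hmissed.trans ((iidSample_codedLaw_forall_ne_codePoint_le a m).trans ?_)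
    have hw := sub_nonneg.2 (sq_hardWeight_mem_Ioo a.1).2.le
    have hα₀ := hα.1.le
    gcongr
    linarith

theorem learnable_range_codedLaw : Learnable (Set.range codedLaw) := by
  have hbase {α : ℝ} (hα : α ∈ Set.Ioo (0 : ℝ) 1) : (α / 2) ^ 2 ∈ Set.Ioo (0 : ℝ) 1 :=
    ⟨pow_pos (half_pos hα.1) 2,
      pow_lt_one₀ (half_pos hα.1).le ((half_lt_self hα.1).trans hα.2) two_ne_zero⟩
  have hsize {α β : ℝ} (hα : α ∈ Set.Ioo (0 : ℝ) 1) (hβ : β ∈ Set.Ioo (0 : ℝ) 1) :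
      ∃ m : ℕ, (1 - (α / 2) ^ 2) ^ m < β :=
    exists_pow_lt_of_lt_one hβ.1 (sub_lt_self 1 (hbase hα).1)
  choose! nC hnC using fun α hα β hβ => hsize (α := α) (β := β) hα hβ
  refine ⟨decoder, nC, ?_⟩
  rintro _ ⟨a, rfl⟩ α hα β hβ m hm
  refine (ofReal_one_sub_le_measure_le_iff .of_discrete _ hβ.1.le).2
    ((iidSample_lt_tvDist_decoder_le a hα m).trans (ENNReal.ofReal_le_ofReal ?_))
  exact (pow_le_pow_of_le_one (sub_nonneg.2 (hbase hα).2.le) (sub_le_self 1 (hbase hα).1.le)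
    hm).trans (hnC α hα β hβ).le

end HardClass

section LowerBound

lemma two_mul_card_filter_le {ι : Type*} (Z : Finset ι) (p : ι → Prop) [DecidablePred p]
    {φ : ι → ι} (hφ : Function.Injective φ) (hZ : ∀ b ∈ Z, φ b ∈ Z) (hp : ∀ b, p b → ¬ p (φ b)) :
    2 * (Z.filter p).card ≤ Z.card := by
  have hflip : (Z.filter p).card ≤ (Z.filter fun b => ¬ p b).card :=
    Finset.card_le_card_of_injOn φ
      (fun b hb => by
        obtain ⟨hbZ, hpb⟩ := Finset.mem_filter.1 hb
        exact Finset.mem_filter.2 ⟨hZ b hbZ, hp b hpb⟩)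
      hφ.injOn
  have hsplit := Finset.card_filter_add_card_filter_not (s := Z) p
  omega

open Classical in
lemma exists_measureReal_le_half {Ω ι : Type*} [MeasurableSpace Ω] (P : Measure Ω)
    [IsProbabilityMeasure P] {Z : Finset ι} (hZ : Z.Nonempty) {E : ι → Set Ω}
    (hE : ∀ b, MeasurableSet (E b))
    (hcard : ∀ ω, 2 * (Z.filter fun b => ω ∈ E b).card ≤ Z.card) :
    ∃ b ∈ Z, P.real (E b) ≤ 1 / 2 := by
  have hint : ∀ b ∈ Z, Integrable ((E b).indicator (1 : Ω → ℝ)) P := fun b _ =>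
    (integrable_const 1).indicator (hE b)
  have hpoint (ω : Ω) : ∑ b ∈ Z, (E b).indicator (1 : Ω → ℝ) ω ≤ Z.card * (1 / 2) := by
    have hcount : ∑ b ∈ Z, (E b).indicator (1 : Ω → ℝ) ω = (Z.filter fun b => ω ∈ E b).card := by
      simp [Set.indicator_apply]
    have hcard' : (2 : ℝ) * (Z.filter fun b => ω ∈ E b).card ≤ Z.card := mod_cast hcard ω
    linarith
  refine Finset.exists_le_of_sum_le hZ ?_
  calc ∑ b ∈ Z, P.real (E b) = ∫ ω, ∑ b ∈ Z, (E b).indicator 1 ω ∂P := by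
        rw [integral_finsetSum _ hint]
        exact Finset.sum_congr rfl fun b _ => (integral_indicator_one (hE b)).symm
    _ ≤ ∫ _, (Z.card : ℝ) * (1 / 2) ∂P :=
        integral_mono (integrable_finsetSum _ hint) (integrable_const _) hpoint
    _ = ∑ _b ∈ Z, (1 / 2 : ℝ) := by simp

/-- The positions that a sample with the positions `J` leaves unseen. -/
def unseen (N : ℕ) {n : ℕ} (J : Fin n → ℕ) : Finset ℕ :=
  Finset.Icc 1 (N + 1) \ Finset.univ.image J

lemma zero_notMem_unseen (N : ℕ) {n : ℕ} (J : Fin n → ℕ) : 0 ∉ unseen N J := by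
  simp [unseen]

lemma le_two_mul_card_unseen {n N : ℕ} (hnN : 2 * n ≤ N + 1) (J : Fin n → ℕ) :
    N + 1 ≤ 2 * (unseen N J).card := by
  have hsdiff : (Finset.Icc 1 (N + 1)).card - (Finset.univ.image J).card ≤ (unseen N J).card :=
    Finset.le_card_sdiff _ _
  have himage : (Finset.univ.image J).card ≤ n := Finset.card_image_le.trans (by simp)
  rw [Nat.card_Icc] at hsdiff
  omega

lemma half_le_uniformIcc_unseen {n N : ℕ} (hnN : 2 * n ≤ N + 1) (J : Fin n → ℕ) :
    1 / 2 ≤ (uniformIcc N : Measure ℕ).real (unseen N J) := by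
  classical
  change 1 / 2 ≤ (PMF.uniformOfFinset (Finset.Icc 1 (N + 1)) _).toMeasure.real _
  have hfilter : (Finset.Icc 1 (N + 1)).filter (· ∈ (unseen N J : Set ℕ)) = unseen N J :=
    Finset.filter_mem_eq_inter.trans (Finset.inter_eq_right.2 Finset.sdiff_subset)
  rw [measureReal_def, PMF.toMeasure_uniformOfFinset_apply _ _ .of_discrete,
    Finset.filter_congr_decidable, hfilter, Nat.card_Icc, Nat.add_sub_cancel, ENNReal.toReal_div,
    ENNReal.toReal_natCast, ENNReal.toReal_natCast, div_le_div_iff₀ two_pos (by positivity),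
    one_mul, mul_comm]
  exact_mod_cast le_two_mul_card_unseen hnN J

lemma le_tvDist_observationLaw_symmDiff (j N : ℕ) (b : Finset ℕ) {F : Finset ℕ} (hF : 0 ∉ F) :
    hardWeight j * (uniformIcc N : Measure ℕ).real F ≤
      tvDist (observationLaw j N b) (observationLaw j N (symmDiff b F)) := by
  have hflipped : observe (symmDiff b F) ⁻¹' (observe b '' F) = ∅ := by
    refine Set.eq_empty_of_forall_notMem ?_
    rintro i ⟨l, hl, hli⟩
    obtain rfl : l = i := congrArg Prod.fst hli
    have hlabel : (if l ∈ b ∧ l ≠ 0 then 2 else 0) = if l ∈ symmDiff b F ∧ l ≠ 0 then 2 else 0 :=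
      congrArg Prod.snd hli
    have hl' : l ∈ F := hl
    have hl₀ : l ≠ 0 := fun h => hF (h ▸ hl')
    by_cases hb : l ∈ b <;> simp [Finset.mem_symmDiff, hb, hl', hl₀] at hlabel
  calc hardWeight j * (uniformIcc N : Measure ℕ).real F
      ≤ (positionLaw j N : Measure ℕ).real F := by
        rw [positionLaw, mixture_real_apply]
        exact le_add_of_nonneg_right
          (mul_nonneg (sub_nonneg.2 (hardWeight_mem_Ioo j).2.le) measureReal_nonneg)
    _ ≤ (positionLaw j N : Measure ℕ).real (observe b ⁻¹' (observe b '' F)) :=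
        measureReal_mono (Set.subset_preimage_image _ _)
    _ = (observationLaw j N b : Measure (ℕ × ℕ)).real (observe b '' F) -
          (observationLaw j N (symmDiff b F) : Measure (ℕ × ℕ)).real (observe b '' F) := by
        rw [observationLaw_real_apply, observationLaw_real_apply, hflipped, measureReal_empty,
          sub_zero]
    _ ≤ _ := measureReal_sub_le_tvDist _ _ .of_discrete

lemma iidSample_observationLaw (j N n : ℕ) (b : Finset ℕ) (E : Set (Fin n → ℕ × ℕ)) :
    iidSample (observationLaw j N b) n E =
      iidSample (positionLaw j N) n {J | (fun t => observe b (J t)) ∈ E} := by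
  have hmap : iidSample (observationLaw j N b) n =
      (iidSample (positionLaw j N) n).map fun J t => observe b (J t) :=
    (Measure.pi_map_pi (μ := fun _ : Fin n => (positionLaw j N : Measure ℕ))
      (f := fun _ => observe b) fun _ => Measurable.of_discrete.aemeasurable).symm
  rw [hmap, Measure.map_apply .of_discrete .of_discrete]
  rfl

lemma observe_symmDiff_unseen (N : ℕ) {n : ℕ} (b : Finset ℕ) (J : Fin n → ℕ) (t : Fin n) :
    observe (symmDiff b (unseen N J)) (J t) = observe b (J t) := by
  have ht : J t ∉ unseen N J := by simp [unseen]
  simp only [observe, Finset.mem_symmDiff, ht, false_and, or_false, not_false_eq_true, and_true]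

lemma lt_tvDist_symmDiff_unseen {j n N : ℕ} (hnN : 2 * n ≤ N + 1)
    (f : (Fin n → ℕ × ℕ) → ProbabilityMeasure (ℕ × ℕ)) {r : ℝ} (hr : r < hardWeight j / 4)
    {b : Finset ℕ} {J : Fin n → ℕ}
    (hb : tvDist (f fun t => observe b (J t)) (observationLaw j N b) ≤ r) :
    r < tvDist (f fun t => observe (symmDiff b (unseen N J)) (J t))
      (observationLaw j N (symmDiff b (unseen N J))) := by
  simp only [observe_symmDiff_unseen]
  have hfar : hardWeight j * (1 / 2) ≤
      tvDist (observationLaw j N b) (observationLaw j N (symmDiff b (unseen N J))) :=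
    (mul_le_mul_of_nonneg_left (half_le_uniformIcc_unseen hnN J) (hardWeight_mem_Ioo j).1.le).trans
      (le_tvDist_observationLaw_symmDiff j N b (zero_notMem_unseen N J))
  have htriangle := tvDist_triangle (observationLaw j N b) (f fun t => observe b (J t))
    (observationLaw j N (symmDiff b (unseen N J)))
  rw [tvDist_comm _ (f _)] at htriangle
  linarith

lemma exists_iidSample_observationLaw_le_half (j n : ℕ)
    (f : (Fin n → ℕ × ℕ) → ProbabilityMeasure (ℕ × ℕ)) {r : ℝ} (hr : r < hardWeight j / 4) :
    ∃ N b, iidSample (observationLaw j N b) n {S | tvDist (f S) (observationLaw j N b) ≤ r} ≤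
      ENNReal.ofReal (1 / 2) := by
  classical
  let N := 2 * n
  let Z := (Finset.Icc 1 (N + 1)).powerset
  have hN : 2 * n ≤ N + 1 := Nat.le_succ _
  have hZ {b : Finset ℕ} (J : Fin n → ℕ) (hb : b ∈ Z) : symmDiff b (unseen N J) ∈ Z :=
    Finset.mem_powerset.2 (Finset.symmDiff_subset_union.trans
      (Finset.union_subset (Finset.mem_powerset.1 hb) Finset.sdiff_subset))
  obtain ⟨b, -, hb⟩ := exists_measureReal_le_half (iidSample (positionLaw j N) n)
    (Finset.powerset_nonempty (Finset.Icc 1 (N + 1)))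
    (E := fun b => {J | tvDist (f fun t => observe b (J t)) (observationLaw j N b) ≤ r})
    (fun _ => .of_discrete) fun J =>
      two_mul_card_filter_le Z _ (symmDiff_left_injective (unseen N J)) (fun _ => hZ J)
        fun _ hb => not_le.2 (lt_tvDist_symmDiff_unseen hN f hr hb)
  refine ⟨N, b, ?_⟩
  rw [iidSample_observationLaw]
  exact (ENNReal.le_ofReal_iff_toReal_le (measure_ne_top _ _) (by norm_num)).2 hb

theorem not_subtractiveRobustlyLearnable_range_codedLaw (α : ℝ) :
    ¬ SubtractiveRobustlyLearnable α (Set.range codedLaw) := by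
  rintro ⟨A, nC, hA⟩
  obtain ⟨j, hj⟩ := exists_nat_ge (16 * α)
  let w := hardWeight j
  obtain ⟨hw₀, hw₁⟩ : w ∈ Set.Ioo (0 : ℝ) 1 := hardWeight_mem_Ioo j
  have hαw : α * w ≤ 1 / 16 := by
    change α * (1 / ((j : ℝ) + 2)) ≤ 1 / 16
    rw [mul_one_div, div_le_iff₀ (by positivity)]
    linarith
  have hw16 : w / 16 ∈ Set.Ioo (0 : ℝ) 1 := ⟨by linarith, by linarith⟩
  obtain ⟨N, b, hfail⟩ := exists_iidSample_observationLaw_le_half j (nC (w / 16) (1 / 4))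
    (A.out _) (r := α * w ^ 2 + w / 16) (show _ < w / 4 by nlinarith)
  have hlearn := hA (w ^ 2) (sq_hardWeight_mem_Ioo j) (observationLaw j N b)
    ⟨pointMass (codePoint (j, N, b)), (j, N, b), rfl⟩ (w / 16) hw16 (1 / 4) (by norm_num) _ le_rfl
  have hle := (ENNReal.ofReal_le_ofReal_iff (by norm_num)).1 (hlearn.trans hfail)
  norm_num at hle

lemma RobustlyLearnable.subtractiveRobustlyLearnable {X : Type*} [MeasurableSpace X] {α : ℝ}
    (hα : 0 ≤ α) {C : Set (ProbabilityMeasure X)} (h : RobustlyLearnable α C) :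
    SubtractiveRobustlyLearnable α C := by
  obtain ⟨A, nC, hA⟩ := h
  refine ⟨A, nC, fun η hη p hp ε hε δ hδ n hn => (hA p ε hε δ hδ n hn).trans
    (measure_mono fun S hS => ?_)⟩
  obtain ⟨q, hq⟩ := hp
  have hclass : tvDistToClass p C ≤ ENNReal.ofReal η :=
    (iInf₂_le _ hq).trans (ENNReal.ofReal_le_ofReal (tvDist_mixture_le hη q p))
  have hαη := mul_nonneg hα hη.1.le
  refine (ENNReal.ofReal_le_ofReal_iff (add_nonneg hαη hε.1.le)).1 ?_
  calc ENNReal.ofReal (tvDist (A.out n S) p)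
      ≤ ENNReal.ofReal α * tvDistToClass p C + ENNReal.ofReal ε := hS
    _ ≤ ENNReal.ofReal α * ENNReal.ofReal η + ENNReal.ofReal ε := by gcongr
    _ = ENNReal.ofReal (α * η + ε) := by
        rw [ENNReal.ofReal_add hαη hε.1.le, ENNReal.ofReal_mul hα]

end LowerBound

end DistLearn

theorem mainTheorem7_general :
    (∀ (X : Type*) [MeasurableSpace X] [MeasurableSpace.CountablyGenerated X]
      (Q : Set (ProbabilityMeasure X)),
      DistLearn.Learnable Q → DistLearn.AdditiveRobustlyLearnable 3 Q) ∧
    ∃ Q : Set (ProbabilityMeasure (ℕ × ℕ)), DistLearn.ApproxDPLearnable Q ∧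
      (∀ α : ℝ, 0 ≤ α → ¬ DistLearn.RobustlyLearnable α Q) ∧
      ∀ α : ℝ, ¬ DistLearn.SubtractiveRobustlyLearnable α Q :=
  ⟨fun _ _ _ _ hQ => hQ.additiveRobustlyLearnable, Set.range DistLearn.codedLaw,
    DistLearn.learnable_range_codedLaw.approxDPLearnable,
    fun α hα hQ => DistLearn.not_subtractiveRobustlyLearnable_range_codedLaw α
      (hQ.subtractiveRobustlyLearnable hα),
    DistLearn.not_subtractiveRobustlyLearnable_range_codedLaw⟩

theorem mainTheorem7 :
    (∀ (X : Type*) [MeasurableSpace X] [MeasurableSpace.CountablyGenerated X]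
      (Q : Set (ProbabilityMeasure X)),
      DistLearn.ApproxDPLearnable Q → DistLearn.AdditiveRobustlyLearnable 3 Q) ∧
    (∃ Q : Set (ProbabilityMeasure (ℕ × ℕ)), DistLearn.ApproxDPLearnable Q ∧
      ∀ α : ℝ, 1 ≤ α → ¬ DistLearn.RobustlyLearnable α Q) ∧
    (∃ Q : Set (ProbabilityMeasure (ℕ × ℕ)), DistLearn.ApproxDPLearnable Q ∧
      ∀ α : ℝ, 1 ≤ α → ¬ DistLearn.SubtractiveRobustlyLearnable α Q) :=
  have ⟨hadditive, Q, hprivate, hrobust, hsubtractive⟩ := mainTheorem7_general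
  ⟨fun X _ _ Q hQ => hadditive X Q hQ.learnable,
    ⟨Q, hprivate, fun α hα => hrobust α (zero_le_one.trans hα)⟩,
    ⟨Q, hprivate, fun α _ => hsubtractive α⟩⟩
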